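/- **Theorem.** Let $m\ge 0$ be an integer and let $X$ be a Polish space (separable and completely metrizable) which is locally $k$-connected for all integers $0\le k<m$. If $X$ has the discrete $m$-discs property, then $X$ is strongly universal in dimension $m$. Here the notions are as follows. - $X$ is *locally $k$-connected* if for every $x\in X$ and every neighbourhood $U$ of $x$ there is a neighbourhood $V\subset U$ of $x$ such that every continuous map from the $k$-sphere $S^k$ into $V$ extends to a continuous map from the closed ball $B^{k+1}$ into $U$. - Two maps $f,g\colon T\to X$ are *$\mathcal U$-close*, for an open cover $\mathcal U$ of $X$, if for each $t\in T$ there is $U\in\mathcal U$ containing both $f(t)$ and $g(t)$. - $X$ has the *discrete $m$-discs property* if for every sequence of continuous maps $f_n\colon [0,1]^m\to X$, $n\in\mathbb N$, and every open cover $\mathcal U$ of $X$ there are continuous maps $g_n\colon[0,1]^m\to X$ such that: each $x\in X$ has a neighbourhood $U$ with $g_n([0,1]^m)\cap U=\emptyset$ for all sufficiently large $n$; $f_n$ and $g_n$ are $\mathcal U$-close for every $n$; and the images $g_n([0,1]^m)$ are pairwise disjoint. - A space has *dimension at most $m$* if its small inductive dimension is at most $m$: each point has a basis of neighbourhoods whose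 boundaries are empty (if $m=0$), respectively have dimension at most $m-1$ (if $m>0$). The empty space has dimension at most $m$ for every $m\ge 0$. - $X$ is *strongly universal in dimension $m$* if for every Polish space $Y$ of dimension at most $m$, every continuous map $f\colon Y\to X$ and every open cover $\mathcal U$ of $X$, there is a closed embedding $g\colon Y\to X$ such that $f$ and $g$ are $\mathcal U$-close. -/

import Mathlib

universe u v

open Set Filter Topology

/-- `𝒰` is an open cover of the space `X`. -/
def IsOpenCovering {X : Type*} [TopologicalSpace X] (𝒰 : Set (Set X)) : Prop :=
  (∀ U ∈ 𝒰, IsOpen U) ∧ ⋃₀ 𝒰 = univ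

/-- Two maps `f g : T → X` are `𝒰`-close if for every `t` some member of `𝒰` contains both
`f t` and `g t`. -/
def CoverClose {T X : Type*} (𝒰 : Set (Set X)) (f g : T → X) : Prop :=
  ∀ t : T, ∃ U ∈ 𝒰, f t ∈ U ∧ g t ∈ U

/-- `X` is locally `k`-connected: for every point `x` and every neighbourhood `U` of `x` there is
a neighbourhood `V ⊆ U` of `x` such that every continuous map from the `k`-sphere into `V` extends
to a continuous map from the closed `(k+1)`-ball into `U`. -/
def LocallyKConnected (k : ℕ) (X : Type*) [TopologicalSpace X] : Prop :=
  ∀ x : X, ∀ U ∈ 𝓝 x, ∃ V ∈ 𝓝 x, V ⊆ U ∧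
    ∀ f : C(Metric.sphere (0 : EuclideanSpace ℝ (Fin (k + 1))) 1, X), (∀ s, f s ∈ V) →
      ∃ F : C(Metric.closedBall (0 : EuclideanSpace ℝ (Fin (k + 1))) 1, X), (∀ z, F z ∈ U) ∧
        ∀ s, F (inclusion Metric.sphere_subset_closedBall s) = f s

/-- `X` has the discrete `m`-discs property: every sequence of maps of the `m`-cube `[0,1]^m`
into `X` can be approximated, with respect to any open cover, by a sequence of maps whose images
are locally finite and pairwise disjoint. -/
def DiscreteDiscsProperty (m : ℕ) (X : Type*) [TopologicalSpace X] : Prop :=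
  ∀ (f : ℕ → C(Fin m → unitInterval, X)) (𝒰 : Set (Set X)), IsOpenCovering 𝒰 →
    ∃ g : ℕ → C(Fin m → unitInterval, X),
      (∀ x : X, ∃ U ∈ 𝓝 x, ∀ᶠ n in atTop, range (g n) ∩ U = ∅) ∧
      (∀ n, CoverClose 𝒰 (f n) (g n)) ∧
      Pairwise fun i j => Disjoint (range (g i)) (range (g j))

/-- A map `f : Y → X` is approximable by closed embeddings. -/
def ApproximableByClosedEmbeddings {Y X : Type*} [TopologicalSpace Y] [TopologicalSpace X]
    (f : Y → X) : Prop :=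
  ∀ 𝒰 : Set (Set X), IsOpenCovering 𝒰 → ∃ g : Y → X, IsClosedEmbedding g ∧ CoverClose 𝒰 f g

/-- `X` is strongly universal in dimension `m`: every continuous map into `X` from a Polish space
of dimension at most `m` is approximable by closed embeddings. -/
def StronglyUniversal (m : ℕ) (X : Type u) [TopologicalSpace X] : Prop :=
  ∀ (Y : Type v) [TopologicalSpace Y] [PolishSpace Y], HasSmallInductiveDimensionLE Y m →
    ∀ f : Y → X, Continuous f → ApproximableByClosedEmbeddings f

/-! Fix complete metrics on X and Y and replace open covers of X by positive 1-Lipschitz control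
functions. The closed embedding is a limit of maps g_n : Y → X in which every point of X has a
neighbourhood whose preimage under g_n has diameter at most 2^-n. If each later correction is small
compared with the size of those neighbourhoods, the limit inherits preimages of arbitrarily small
diameter (`exists_approx_isClosedEmbedding`). Such a map is injective, and it is proper because an
ultrafilter on Y with convergent image is Cauchy (`isClosedEmbedding_of_small_fibres`).

One stage is `exists_approx_small_fibres`. Since dim Y ≤ m, the space Y has a countable star-finite
open cover by small sets of order at most m + 1. This rests on the decomposition of Y into m + 1
zero-dimensional subsets, each of which contributes one disjoint family. The cover gives a map u
from Y to its nerve, a locally finite complex of dimension at most m, and the new map is q ∘ u,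
where q sends the nerve to X with locally finite cell images and sends disjoint cells to disjoint
sets. Each x then has a neighbourhood missing all cell images that do not contain x. Two points of Y
mapped into it lie in cells that meet, hence in a common member of the cover.

The map q is built skeleton by skeleton (`GridCell.exists_realization`). Local k-connectedness for k
< m fills the cells of dimension at most m with control. The discrete discs property then puts the
fillings in general position. It does not respect boundaries, so an approximation of a d-cell is
shrunk and joined to the old boundary by a thin collar (`exists_collar`). The collar is not in
general position, but it stays near the boundary of the cell, whose position is already controlled.
Two successive perturbations per dimension therefore suffice (`GridCell.exists_isGoodBelow_succ`).

Cubical complexes are used throughout: a cell is a face of the integer grid, so the nerve and the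
subdivided collar are treated by the same lemmas. -/

/-- `S` is zero-dimensional: every cover of `S` by two open sets of the ambient space shrinks to
one whose members are disjoint on `S`. -/
def ZeroDimOn {Y : Type*} [TopologicalSpace Y] (S : Set Y) : Prop :=
  ∀ W₀ W₁ : Set Y, IsOpen W₀ → IsOpen W₁ → S ⊆ W₀ ∪ W₁ →
    ∃ V₀ V₁ : Set Y, IsOpen V₀ ∧ IsOpen V₁ ∧ V₀ ⊆ W₀ ∧ V₁ ⊆ W₁ ∧ S ⊆ V₀ ∪ V₁ ∧
      ∀ y ∈ S, y ∈ V₀ → y ∉ V₁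

/-! ### Zero-dimensional subsets and the countable sum theorem. -/

namespace ZeroDimOn

variable {Y T : Type*} [TopologicalSpace Y] [TopologicalSpace T]

theorem inter_isClosed {S C : Set Y} (hS : ZeroDimOn S) (hC : IsClosed C) :
    ZeroDimOn (S ∩ C) := by
  intro W₀ W₁ h₀ h₁ hcov
  obtain ⟨V₀, V₁, o₀, o₁, s₀, s₁, c, d⟩ := hS (W₀ ∪ Cᶜ) W₁ (h₀.union hC.isOpen_compl) h₁ (by
    intro y hy
    by_cases hyC : y ∈ C
    · rcases hcov ⟨hy, hyC⟩ with h | h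
      · exact Or.inl (Or.inl h)
      · exact Or.inr h
    · exact Or.inl (Or.inr hyC))
  refine ⟨V₀ ∩ W₀, V₁, o₀.inter h₀, o₁, inter_subset_right, s₁, ?_,
    fun y hy h => d y hy.1 h.1⟩
  rintro y ⟨hy, hyC⟩
  rcases c hy with h | h
  · exact Or.inl ⟨h, (s₀ h).resolve_right (fun hn => hn hyC)⟩
  · exact Or.inr h

theorem image_iff {e : T → Y} (he : IsInducing e) {S : Set T} :
    ZeroDimOn (e '' S) ↔ ZeroDimOn S := by
  constructor
  · intro h W₀ W₁ h₀ h₁ hcov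
    obtain ⟨W₀', h₀', rfl⟩ := he.isOpen_iff.1 h₀
    obtain ⟨W₁', h₁', rfl⟩ := he.isOpen_iff.1 h₁
    obtain ⟨V₀, V₁, o₀, o₁, s₀, s₁, c, d⟩ := h W₀' W₁' h₀' h₁' (by
      rintro _ ⟨t, ht, rfl⟩
      exact hcov ht)
    exact ⟨e ⁻¹' V₀, e ⁻¹' V₁, o₀.preimage he.continuous, o₁.preimage he.continuous,
      preimage_mono s₀, preimage_mono s₁, fun t ht => c (mem_image_of_mem e ht),
      fun t ht => d _ (mem_image_of_mem e ht)⟩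
  · intro h W₀ W₁ h₀ h₁ hcov
    obtain ⟨V₀, V₁, o₀, o₁, s₀, s₁, c, d⟩ := h (e ⁻¹' W₀) (e ⁻¹' W₁)
      (h₀.preimage he.continuous) (h₁.preimage he.continuous)
      (fun t ht => hcov (mem_image_of_mem e ht))
    obtain ⟨V₀', o₀', rfl⟩ := he.isOpen_iff.1 o₀
    obtain ⟨V₁', o₁', rfl⟩ := he.isOpen_iff.1 o₁
    refine ⟨V₀' ∩ W₀, V₁' ∩ W₁, o₀'.inter h₀, o₁'.inter h₁, inter_subset_right,
      inter_subset_right, ?_, ?_⟩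
    · rintro _ ⟨t, ht, rfl⟩
      rcases c ht with h | h
      · exact Or.inl ⟨h, s₀ h⟩
      · exact Or.inr ⟨h, s₁ h⟩
    · rintro _ ⟨t, ht, rfl⟩ h h'
      exact d t ht h.1 h'.1

/-- Shrinking the cover of `C` by the complements of the two closures splits `C` into two disjoint
closed pieces. Adding one piece to each closure keeps the two sets closed and disjoint, and
normality separates them again. This is the inductive step of the sum theorem. -/
theorem exists_enlarge [NormalSpace T] {C G H : Set T} (hC : IsClosed C) (hz : ZeroDimOn C)
    (hGH : Disjoint (closure G) (closure H)) :
    ∃ G' H' : Set T, IsOpen G' ∧ IsOpen H' ∧ closure G ⊆ G' ∧ closure H ⊆ H' ∧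
      Disjoint (closure G') (closure H') ∧ C ⊆ G' ∪ H' := by
  obtain ⟨V₀, V₁, o₀, o₁, s₀, s₁, c, d⟩ := hz (closure H)ᶜ (closure G)ᶜ
    isClosed_closure.isOpen_compl isClosed_closure.isOpen_compl (by
      intro y _
      by_cases h : y ∈ closure H
      · exact Or.inr fun h' => hGH.notMem_of_mem_left h' h
      · exact Or.inl h)
  have hA : IsClosed (closure G ∪ C \ V₁) := isClosed_closure.union (hC.sdiff o₁)
  have hB : IsClosed (closure H ∪ C \ V₀) := isClosed_closure.union (hC.sdiff o₀)
  have hAB : closure G ∪ C \ V₁ ⊆ (closure H ∪ C \ V₀)ᶜ := by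
    rintro y (hy | hy) (hy' | hy')
    · exact hGH.notMem_of_mem_left hy hy'
    · exact (c hy'.1).elim hy'.2 fun h => s₁ h hy
    · exact (c hy.1).elim (fun h => s₀ h hy') hy.2
    · exact (c hy.1).elim hy'.2 hy.2
  obtain ⟨G', oG, hG, hG'⟩ := normal_exists_closure_subset hA hB.isOpen_compl hAB
  obtain ⟨H', oH, hH, hH'⟩ := normal_exists_closure_subset hB isClosed_closure.isOpen_compl
    (subset_compl_comm.1 hG')
  refine ⟨G', H', oG, oH, subset_union_left.trans hG, subset_union_left.trans hH,
    (disjoint_compl_left_iff_subset.2 subset_rfl).symm.mono_right hH', fun y hy => ?_⟩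
  by_cases h : y ∈ V₁
  · exact Or.inr (hH (Or.inr ⟨hy, fun h' => d y hy h' h⟩))
  · exact Or.inl (hG (Or.inr ⟨hy, h⟩))

theorem univ_of_iUnion [NormalSpace T] (C : ℕ → Set T) (hC : ∀ n, IsClosed (C n))
    (hz : ∀ n, ZeroDimOn (C n)) (hcov : ⋃ n, C n = univ) : ZeroDimOn (univ : Set T) := by
  intro W₀ W₁ h₀ h₁ hW
  -- The complements of `W₁` and `W₀` are put into the two sides from the start; disjointness of the
  -- sides then forces the final sets into `W₀` and `W₁`.
  have hstart : ∃ p : Set T × Set T, IsOpen p.1 ∧ IsOpen p.2 ∧ W₁ᶜ ⊆ p.1 ∧ W₀ᶜ ⊆ p.2 ∧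
      Disjoint (closure p.1) (closure p.2) := by
    have hd : W₁ᶜ ⊆ W₀ := fun y hy => (hW (mem_univ y)).resolve_right hy
    obtain ⟨G, oG, hG, hG'⟩ := normal_exists_closure_subset h₁.isClosed_compl h₀ hd
    obtain ⟨H, oH, hH, hH'⟩ := normal_exists_closure_subset h₀.isClosed_compl
      isClosed_closure.isOpen_compl (compl_subset_compl.2 hG')
    exact ⟨(G, H), oG, oH, hG, hH,
      (disjoint_compl_left_iff_subset.2 subset_rfl).symm.mono_right hH'⟩
  obtain ⟨p₀, hp₀⟩ := hstart
  choose! G' H' oG oH sG sH dGH cGH using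
    fun (n : ℕ) (p : Set T × Set T) (h : Disjoint (closure p.1) (closure p.2)) =>
      exists_enlarge (hC n) (hz n) h
  let p : ℕ → Set T × Set T := fun n => Nat.rec p₀ (fun n p => (G' n p, H' n p)) n
  have hps : ∀ n, p (n + 1) = (G' n (p n), H' n (p n)) := fun n => rfl
  have hdis : ∀ n, Disjoint (closure (p n).1) (closure (p n).2) := by
    intro n
    induction n with
    | zero => exact hp₀.2.2.2.2
    | succ n ih => rw [hps]; exact dGH n _ ih
  have hmono₁ : Monotone fun n => (p n).1 := monotone_nat_of_le_succ fun n => by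
    simp only [hps]; exact subset_closure.trans (sG n _ (hdis n))
  have hmono₂ : Monotone fun n => (p n).2 := monotone_nat_of_le_succ fun n => by
    simp only [hps]; exact subset_closure.trans (sH n _ (hdis n))
  have hopen : ∀ n, IsOpen (p n).1 ∧ IsOpen (p n).2 := by
    rintro (_ | n)
    · exact ⟨hp₀.1, hp₀.2.1⟩
    · rw [hps]; exact ⟨oG n _ (hdis n), oH n _ (hdis n)⟩
  have hdis' : ∀ n k y, y ∈ (p n).1 → y ∉ (p k).2 := fun n k y h h' =>
    (hdis (max n k)).notMem_of_mem_left (subset_closure (hmono₁ (le_max_left n k) h))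
      (subset_closure (hmono₂ (le_max_right n k) h'))
  refine ⟨⋃ n, (p n).1, ⋃ n, (p n).2, isOpen_iUnion fun n => (hopen n).1,
    isOpen_iUnion fun n => (hopen n).2, ?_, ?_, ?_, ?_⟩
  · refine iUnion_subset fun n y hy => by_contra fun hy' => ?_
    exact hdis' n 0 y hy (hp₀.2.2.2.1 hy')
  · refine iUnion_subset fun n y hy => by_contra fun hy' => ?_
    exact hdis' 0 n y (hp₀.2.2.1 hy') hy
  · intro y hy
    rw [← hcov] at hy
    obtain ⟨n, hn⟩ := mem_iUnion.1 hy
    have : y ∈ (p (n + 1)).1 ∪ (p (n + 1)).2 := by rw [hps]; exact cGH n _ (hdis n) hn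
    exact Or.imp (fun h => mem_iUnion.2 ⟨n + 1, h⟩) (fun h => mem_iUnion.2 ⟨n + 1, h⟩) this
  · intro y _ h h'
    obtain ⟨n, hn⟩ := mem_iUnion.1 h
    obtain ⟨k, hk⟩ := mem_iUnion.1 h'
    exact hdis' n k y hn hk

/-- The countable closed sum theorem for zero-dimensional subsets. -/
theorem of_iUnion [TopologicalSpace.MetrizableSpace Y] {ι : Type*} [Countable ι] {S : Set Y}
    (C : ι → Set Y) (hC : ∀ n, IsClosed (C n)) (hz : ∀ n, ZeroDimOn (S ∩ C n))
    (hcov : S ⊆ ⋃ n, C n) : ZeroDimOn S := by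
  cases isEmpty_or_nonempty ι
  · have : S = ∅ := by simpa using hcov
    subst this
    exact fun _ _ _ _ _ => ⟨∅, ∅, by simp⟩
  obtain ⟨r, hr⟩ := exists_surjective_nat ι
  have := univ_of_iUnion (T := S) (fun n => (↑) ⁻¹' C (r n))
    (fun n => (hC _).preimage continuous_subtype_val)
    (fun n => by
      rw [← image_iff IsInducing.subtypeVal, Subtype.image_preimage_coe]
      exact hz _)
    (by
      ext ⟨y, hy⟩
      obtain ⟨n, hn⟩ := mem_iUnion.1 (hcov hy)
      obtain ⟨k, rfl⟩ := hr n
      simp only [mem_iUnion, mem_preimage, mem_univ, iff_true]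
      exact ⟨k, hn⟩)
  rw [← image_iff IsInducing.subtypeVal] at this
  simpa using this

theorem empty : ZeroDimOn (∅ : Set Y) :=
  fun _ _ _ _ _ => ⟨∅, ∅, by simp⟩

/-- A set which misses the frontiers of the members of a countable family containing a base at
each of its points is zero-dimensional. -/
theorem of_frontier {S : Set Y} (B : ℕ → Set Y) (hB : ∀ n, IsOpen (B n))
    (hbase : ∀ y ∈ S, ∀ U : Set Y, IsOpen U → y ∈ U → ∃ n, y ∈ B n ∧ B n ⊆ U)
    (hfr : ∀ n, Disjoint S (frontier (B n))) : ZeroDimOn S := by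
  classical
  intro W₀ W₁ h₀ h₁ hcov
  let B' : ℕ → Set Y := fun n => if B n ⊆ W₀ ∨ B n ⊆ W₁ then B n else ∅
  have hB' : ∀ n, IsOpen (B' n) := fun n => by
    by_cases h : B n ⊆ W₀ ∨ B n ⊆ W₁
    · simp only [B', if_pos h, hB]
    · simp only [B', if_neg h, isOpen_empty]
  have hcl : ∀ n, ∀ y ∈ S, y ∈ closure (B' n) → y ∈ B' n := fun n y hy => by
    by_cases h : B n ⊆ W₀ ∨ B n ⊆ W₁
    · simp only [B', if_pos h]
      intro hc
      by_contra hn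
      exact (hfr n).notMem_of_mem_left hy ⟨hc, by rwa [(hB n).interior_eq]⟩
    · simp only [B', if_neg h]; simp
  -- Removing the closures of earlier members makes the family disjoint, and loses no point of `S`,
  -- because on `S` these closures agree with the sets themselves (`hcl`).
  let V : ℕ → Set Y := fun n => B' n \ ⋃ k ∈ Iio n, closure (B' k)
  have hV : ∀ n, IsOpen (V n) := fun n =>
    (hB' n).sdiff ((finite_Iio n).isClosed_biUnion fun _ _ => isClosed_closure)
  have hVd : ∀ n k y, y ∈ V n → y ∈ V k → n = k := by
    have aux : ∀ n k y, y ∈ V n → y ∈ V k → ¬ n < k := fun n k y hn hk hlt =>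
      hk.2 (mem_biUnion (mem_Iio.2 hlt) (subset_closure hn.1))
    intro n k y hn hk
    exact le_antisymm (not_lt.1 (aux k n y hk hn)) (not_lt.1 (aux n k y hn hk))
  refine ⟨⋃ n ∈ {n | B n ⊆ W₀}, V n, ⋃ n ∈ {n | ¬ B n ⊆ W₀}, V n,
    isOpen_biUnion fun n _ => hV n, isOpen_biUnion fun n _ => hV n, ?_, ?_, ?_, ?_⟩
  · refine iUnion₂_subset fun n hn y hy => ?_
    have := hy.1
    simp only [B'] at this
    split_ifs at this
    · exact hn this
    · exact this.elim
  · refine iUnion₂_subset fun n hn y hy => ?_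
    have := hy.1
    simp only [B'] at this
    split_ifs at this with h
    · exact (h.resolve_left hn) this
    · exact this.elim
  · intro y hy
    have hex : ∃ n, y ∈ B' n := by
      rcases hcov hy with h | h
      · obtain ⟨n, hn, hn'⟩ := hbase y hy W₀ h₀ h
        exact ⟨n, by simp only [B', if_pos (Or.inl hn')]; exact hn⟩
      · obtain ⟨n, hn, hn'⟩ := hbase y hy W₁ h₁ h
        exact ⟨n, by simp only [B', if_pos (Or.inr hn')]; exact hn⟩
    have hyV : y ∈ V (Nat.find hex) := by
      refine ⟨Nat.find_spec hex, fun h => ?_⟩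
      obtain ⟨k, hk, hk'⟩ := mem_iUnion₂.1 h
      exact Nat.find_min hex hk (hcl k y hy hk')
    by_cases h : B (Nat.find hex) ⊆ W₀
    · exact Or.inl (mem_biUnion h hyV)
    · exact Or.inr (mem_biUnion h hyV)
  · intro y _ h h'
    obtain ⟨n, hn, hn'⟩ := mem_iUnion₂.1 h
    obtain ⟨k, hk, hk'⟩ := mem_iUnion₂.1 h'
    obtain rfl := hVd n k y hn' hk'
    exact hk hn

end ZeroDimOn

namespace ZeroDimOn

/-- A countable open cover of a zero-dimensional subset has a disjoint open shrinking. -/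
theorem exists_disjoint_shrinking {Y : Type*} [TopologicalSpace Y]
    [TopologicalSpace.MetrizableSpace Y] [SecondCountableTopology Y] {ι : Type*}
    {Z : Set Y} (hZ : ZeroDimOn Z) (W : ι → Set Y) (hW : ∀ i, IsOpen (W i))
    (hcov : Z ⊆ ⋃ i, W i) :
    ∃ V : ι → Set Y, (∀ i, IsOpen (V i)) ∧ (∀ i, V i ⊆ W i) ∧ Z ⊆ ⋃ i, V i ∧
      ∀ i j y, y ∈ V i → y ∈ V j → i = j := by
  let := TopologicalSpace.metrizableSpaceMetric Y
  rcases Z.eq_empty_or_nonempty with rfl | hne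
  · exact ⟨fun _ => ∅, by simp⟩
  have hex : ∀ z : Z, ∃ (i : ι) (A B : Set Y), IsOpen A ∧ IsOpen B ∧ A ⊆ W i ∧ (z : Y) ∈ A ∧
      Z ⊆ A ∪ B ∧ ∀ y ∈ Z, y ∈ A → y ∉ B := by
    rintro ⟨z, hz⟩
    obtain ⟨i, hi⟩ := mem_iUnion.1 (hcov hz)
    obtain ⟨A, B, oA, oB, sA, sB, c, d⟩ := hZ (W i) {z}ᶜ (hW i) isOpen_compl_singleton
      (fun y _ => by
        by_cases h : y = z
        · exact Or.inl (h ▸ hi)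
        · exact Or.inr h)
    exact ⟨i, A, B, oA, oB, sA, (c hz).resolve_right fun h => sB h rfl, c, d⟩
  choose i A B oA oB sA mA c d using hex
  obtain ⟨T, hT, hTU⟩ := TopologicalSpace.isOpen_iUnion_countable A oA
  have hTne : T.Nonempty := by
    obtain ⟨z, hz⟩ := hne
    have : z ∈ ⋃ i ∈ T, A i := hTU ▸ mem_iUnion.2 ⟨⟨z, hz⟩, mA ⟨z, hz⟩⟩
    obtain ⟨t, ht, -⟩ := mem_iUnion₂.1 this
    exact ⟨t, ht⟩
  obtain ⟨r, hr⟩ := hT.exists_eq_range hTne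
  let D : ℕ → Set Y := fun k => A (r k) ∩ ⋂ l ∈ Iio k, B (r l)
  have oD : ∀ k, IsOpen (D k) := fun k =>
    (oA _).inter ((finite_Iio k).isOpen_biInter fun _ _ => oB _)
  have dD : ∀ k l, ∀ y ∈ Z, y ∈ D k → y ∈ D l → k = l := by
    have aux : ∀ k l, ∀ y ∈ Z, y ∈ D k → y ∈ D l → ¬ k < l := fun k l y hy hk hl hlt =>
      d (r k) y hy hk.1 (mem_iInter₂.1 hl.2 k hlt)
    intro k l y hy hk hl
    exact le_antisymm (not_lt.1 (aux l k y hy hl hk)) (not_lt.1 (aux k l y hy hk hl))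
  let P : ι → Set Y := fun j => ⋃ k ∈ {k | i (r k) = j}, D k
  have oP : ∀ j, IsOpen (P j) := fun j => isOpen_biUnion fun k _ => oD k
  have sP : ∀ j, P j ⊆ W j := fun j => iUnion₂_subset fun k hk y hy => by
    rw [← (show i (r k) = j from hk)]
    exact sA _ hy.1
  have dP : ∀ j j', ∀ y ∈ Z, y ∈ P j → y ∈ P j' → j = j' := by
    intro j j' y hy h h'
    obtain ⟨k, hk, hk'⟩ := mem_iUnion₂.1 h
    obtain ⟨l, hl, hl'⟩ := mem_iUnion₂.1 h'
    obtain rfl := dD k l y hy hk' hl'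
    rw [← (show i (r k) = j from hk), ← (show i (r k) = j' from hl)]
  have cP : Z ⊆ ⋃ j, P j := by
    intro y hy
    have hex : ∃ k, y ∈ A (r k) := by
      have : y ∈ ⋃ t ∈ T, A t := hTU ▸ mem_iUnion.2 ⟨⟨y, hy⟩, mA ⟨y, hy⟩⟩
      obtain ⟨t, ht, ht'⟩ := mem_iUnion₂.1 this
      rw [hr] at ht
      obtain ⟨k, rfl⟩ := ht
      exact ⟨k, ht'⟩
    classical
    refine mem_iUnion.2 ⟨i (r (Nat.find hex)), mem_biUnion (x := Nat.find hex) rfl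
      ⟨Nat.find_spec hex, mem_iInter₂.2 fun l hl => ?_⟩⟩
    exact (c (r l) hy).resolve_left (Nat.find_min hex hl)
  -- The sets `P j` are disjoint only on `Z`. Keeping the points nearer to `Z ∩ P j` than to `Z \ P
  -- j` makes them disjoint everywhere. The extended distance gives `⊤` when the second set is
  -- empty.
  let V : ι → Set Y := fun j => P j ∩
    {y | Metric.infEDist y (Z ∩ P j) < Metric.infEDist y (Z \ P j)}
  refine ⟨V, fun j => (oP j).inter (isOpen_lt Metric.continuous_infEDist
    Metric.continuous_infEDist), fun j => inter_subset_left.trans (sP j), ?_, ?_⟩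
  · intro y hy
    obtain ⟨j, hj⟩ := mem_iUnion.1 (cP hy)
    refine mem_iUnion.2 ⟨j, hj, ?_⟩
    change Metric.infEDist y (Z ∩ P j) < Metric.infEDist y (Z \ P j)
    rw [Metric.infEDist_zero_of_mem (show y ∈ Z ∩ P j from ⟨hy, hj⟩), pos_iff_ne_zero]
    intro h
    rw [← Metric.mem_closure_iff_infEDist_zero] at h
    exact closure_minimal (fun x hx => hx.2) (oP j).isClosed_compl h hj
  · intro j j' y hj hj'
    by_contra hne
    have h : Metric.infEDist y (Z \ P j) ≤ Metric.infEDist y (Z ∩ P j') :=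
      Metric.infEDist_anti fun x hx => ⟨hx.1, fun hx' => hne (dP j j' x hx.1 hx' hx.2)⟩
    have h' : Metric.infEDist y (Z \ P j') ≤ Metric.infEDist y (Z ∩ P j) :=
      Metric.infEDist_anti fun x hx => ⟨hx.1, fun hx' => hne (dP j j' x hx.1 hx.2 hx')⟩
    exact lt_irrefl _ ((hj.2.trans_le h).trans (hj'.2.trans_le h'))

end ZeroDimOn

/-! ### Decomposition into zero-dimensional sets and refinements of bounded order. -/

/-- The decomposition theorem: a separable metrizable space of small inductive dimension `< n` is
a union of `n` zero-dimensional subsets. -/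
theorem HasSmallInductiveDimensionLT.exists_zeroDimOn_cover (n : ℕ) :
    ∀ (Y : Type v) [TopologicalSpace Y] [TopologicalSpace.MetrizableSpace Y]
      [SecondCountableTopology Y], HasSmallInductiveDimensionLT Y n →
      ∃ Z : Fin n → Set Y, (⋃ i, Z i = univ) ∧ ∀ i, ZeroDimOn (Z i) := by
  induction n with
  | zero =>
    intro Y _ _ _ h
    rw [hasSmallInductiveDimensionLT_zero_iff] at h
    exact ⟨fun _ => ∅, Subsingleton.elim _ _, fun _ => ZeroDimOn.empty⟩
  | succ n ih =>
    intro Y _ _ _ h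
    let := TopologicalSpace.metrizableSpaceMetric Y
    obtain ⟨s, hs, hfr⟩ : ∃ s : Set (Set Y), TopologicalSpace.IsTopologicalBasis s ∧
        ∀ U ∈ s, HasSmallInductiveDimensionLT (frontier U) n := by
      cases h with
      | succ _ s hs hfr => exact ⟨s, hs, hfr⟩
    obtain ⟨t, hts, htc, ht⟩ := hs.exists_countable
    have ht' : (insert ∅ t).Countable := htc.insert _
    obtain ⟨B, hB⟩ := ht'.exists_eq_range (insert_nonempty _ _)
    have hBo : ∀ k, IsOpen (B k) := fun k => by
      have : B k ∈ insert ∅ t := hB ▸ mem_range_self k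
      rcases this with h | h
      · rw [h]; exact isOpen_empty
      · exact ht.isOpen h
    have hdec : ∀ k, ∃ Z : Fin n → Set Y, (⋃ i, Z i = frontier (B k)) ∧ ∀ i, ZeroDimOn (Z i) := by
      intro k
      have hd : HasSmallInductiveDimensionLT (frontier (B k)) n := by
        have : B k ∈ insert ∅ t := hB ▸ mem_range_self k
        rcases this with h | h
        · rw [h, frontier_empty]; infer_instance
        · exact hfr _ (hts h)
      obtain ⟨Z, hZ, hZ'⟩ := ih _ hd
      refine ⟨fun i => (↑) '' Z i, ?_, fun i =>
        (ZeroDimOn.image_iff IsInducing.subtypeVal).2 (hZ' i)⟩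
      rw [← image_iUnion, hZ]
      simp
    choose Z hZ hZ' using hdec
    -- Disjoint pieces of the frontiers, each a countable union of closed sets. Inside one piece
    -- only one decomposition `Z k` matters, so the sum theorem can combine the sets `Z k i` for
    -- fixed `i`.
    let G : ℕ → Set Y := fun k => frontier (B k) \ ⋃ l ∈ Iio k, frontier (B l)
    have hG : ∀ k, ∃ C : ℕ → Set Y, (∀ l, IsClosed (C l)) ∧ ⋃ l, C l = G k := by
      intro k
      have hcl : IsClosed (⋃ l ∈ Iio k, frontier (B l)) :=
        (finite_Iio k).isClosed_biUnion fun _ _ => isClosed_frontier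
      obtain ⟨F, hF, -, hF', -⟩ := hcl.isOpen_compl.exists_iUnion_isClosed
      refine ⟨fun l => frontier (B k) ∩ F l, fun l => isClosed_frontier.inter (hF l), ?_⟩
      rw [← inter_iUnion, hF']
      rfl
    choose C hC hCG using hG
    have hGd : ∀ k l y, y ∈ G k → y ∈ G l → k = l := by
      have aux : ∀ k l y, y ∈ G k → y ∈ G l → ¬ k < l := fun k l y hk hl hlt =>
        hl.2 (mem_biUnion hlt hk.1)
      intro k l y hk hl
      exact le_antisymm (not_lt.1 (aux l k y hl hk)) (not_lt.1 (aux k l y hk hl))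
    let Wi : Fin n → Set Y := fun i => ⋃ k, Z k i ∩ G k
    -- The extra class is the set of points on no frontier of the base; it is zero-dimensional by
    -- `ZeroDimOn.of_frontier`.
    refine ⟨Fin.cons (⋃ k, frontier (B k))ᶜ Wi, ?_, ?_⟩
    · refine eq_univ_of_forall fun y => ?_
      by_cases hy : ∃ k, y ∈ frontier (B k)
      · classical
        have h1 : y ∈ G (Nat.find hy) := by
          refine ⟨Nat.find_spec hy, fun h => ?_⟩
          obtain ⟨l, hl, hl'⟩ := mem_iUnion₂.1 h
          exact Nat.find_min hy hl hl'
        have h2 := Nat.find_spec hy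
        rw [← hZ] at h2
        obtain ⟨i, hi⟩ := mem_iUnion.1 h2
        refine mem_iUnion.2 ⟨i.succ, ?_⟩
        rw [Fin.cons_succ]
        exact mem_iUnion.2 ⟨_, hi, h1⟩
      · refine mem_iUnion.2 ⟨0, ?_⟩
        rw [Fin.cons_zero]
        simpa using hy
    · refine Fin.cases ?_ fun i => ?_
      · rw [Fin.cons_zero]
        refine ZeroDimOn.of_frontier B hBo ?_ ?_
        · intro y _ U hU hy
          obtain ⟨b, hb, hyb, hbU⟩ := ht.exists_subset_of_mem_open hy hU
          have : b ∈ range B := hB ▸ mem_insert_of_mem _ hb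
          obtain ⟨k, rfl⟩ := this
          exact ⟨k, hyb, hbU⟩
        · intro k
          exact disjoint_left.2 fun y hy hy' => hy (mem_iUnion.2 ⟨k, hy'⟩)
      · rw [Fin.cons_succ]
        refine ZeroDimOn.of_iUnion (ι := ℕ × ℕ) (fun p => C p.1 p.2) (fun p => hC _ _) ?_ ?_
        · rintro ⟨k, l⟩
          have : Wi i ∩ C k l = Z k i ∩ C k l := by
            ext y
            constructor
            · rintro ⟨hy, hyC⟩
              obtain ⟨k', h1, h2⟩ := mem_iUnion.1 hy
              obtain rfl := hGd k' k y h2 (hCG k ▸ mem_iUnion.2 ⟨l, hyC⟩)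
              exact ⟨h1, hyC⟩
            · rintro ⟨hy, hyC⟩
              exact ⟨mem_iUnion.2 ⟨k, hy, hCG k ▸ mem_iUnion.2 ⟨l, hyC⟩⟩, hyC⟩
          rw [this]
          exact (hZ' k i).inter_isClosed (hC _ _)
        · intro y hy
          obtain ⟨k, h1, h2⟩ := mem_iUnion.1 hy
          rw [← hCG] at h2
          obtain ⟨l, hl⟩ := mem_iUnion.1 h2
          exact mem_iUnion.2 ⟨(k, l), hl⟩

/-- A countable open cover of a metrizable space has a countable star-finite open refinement. -/
theorem exists_starFinite_refinement {Y : Type*} [TopologicalSpace Y]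
    [TopologicalSpace.MetrizableSpace Y] (U : ℕ → Set Y) (hU : ∀ n, IsOpen (U n))
    (hcov : ⋃ n, U n = univ) :
    ∃ W : ℕ × ℕ → Set Y, (∀ p, IsOpen (W p)) ∧ ⋃ p, W p = univ ∧ (∀ p, W p ⊆ U p.2) ∧
      ∀ p, {q | (W p ∩ W q).Nonempty}.Finite := by
  let := TopologicalSpace.metrizableSpaceMetric Y
  -- An exhaustion by closed sets, each in the interior of the next, with `F n` covered by `U 0, …,
  -- U n`. The refinement cuts the shell between `F (n - 1)` and `F (n + 1)` by these finitely many
  -- sets, and shells with non-adjacent indices are disjoint.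
  let F : ℕ → Set Y := fun n => {y | ∃ i ≤ n, ((n : ENNReal) + 1)⁻¹ ≤ Metric.infEDist y (U i)ᶜ}
  have hFcl : ∀ n, IsClosed (F n) := fun n => by
    have : F n = ⋃ i ∈ Iic n, {y | ((n : ENNReal) + 1)⁻¹ ≤ Metric.infEDist y (U i)ᶜ} := by
      ext y; simp [F]
    rw [this]
    exact (finite_Iic n).isClosed_biUnion fun i _ =>
      isClosed_le continuous_const Metric.continuous_infEDist
  have hFint : ∀ n, F n ⊆ interior (F (n + 1)) := by
    rintro n y ⟨i, hi, hy⟩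
    refine mem_interior.2 ⟨{y | (((n + 1 : ℕ) : ENNReal) + 1)⁻¹ < Metric.infEDist y (U i)ᶜ},
      fun z hz => ⟨i, hi.trans (Nat.le_succ n), le_of_lt hz⟩,
      isOpen_lt continuous_const Metric.continuous_infEDist, lt_of_lt_of_le ?_ hy⟩
    rw [ENNReal.inv_lt_inv]
    exact_mod_cast Nat.lt_succ_self (n + 1)
  have hFU : ∀ n, ∀ y ∈ F n, ∃ i ≤ n, y ∈ U i := by
    rintro n y ⟨i, hi, hy⟩
    refine ⟨i, hi, by_contra fun h => ?_⟩
    rw [Metric.infEDist_zero_of_mem (show y ∈ (U i)ᶜ from h), nonpos_iff_eq_zero,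
      ENNReal.inv_eq_zero] at hy
    exact ENNReal.add_ne_top.2 ⟨ENNReal.natCast_ne_top n, ENNReal.one_ne_top⟩ hy
  have hFcov : ∀ y, ∃ n, y ∈ F n := by
    intro y
    obtain ⟨i, hi⟩ := mem_iUnion.1 (hcov ▸ mem_univ y)
    have hpos : Metric.infEDist y (U i)ᶜ ≠ 0 := fun h => by
      rw [← Metric.mem_closure_iff_infEDist_zero, (hU i).isClosed_compl.closure_eq] at h
      exact h hi
    obtain ⟨n, hn⟩ := ENNReal.exists_inv_nat_lt hpos
    refine ⟨max i n, i, le_max_left _ _, le_trans ?_ hn.le⟩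
    rw [ENNReal.inv_le_inv]
    exact_mod_cast (le_max_right i n).trans (Nat.le_succ _)
  let W : ℕ × ℕ → Set Y := fun p =>
    {y | y ∈ U p.2 ∧ p.2 ≤ p.1 ∧ y ∈ interior (F (p.1 + 1)) ∧ y ∉ ⋃ k ∈ Iio p.1, F k}
  refine ⟨W, ?_, ?_, fun p y hy => hy.1, ?_⟩
  · rintro ⟨n, i⟩
    have hcl : IsClosed (⋃ k ∈ Iio n, F k) :=
      (finite_Iio n).isClosed_biUnion fun k _ => hFcl k
    by_cases h : i ≤ n
    · have : W (n, i) = U i ∩ (interior (F (n + 1)) ∩ (⋃ k ∈ Iio n, F k)ᶜ) := by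
        ext y; simp only [W, h, mem_ofPred_eq, mem_inter_iff, mem_compl_iff, true_and]
      rw [this]
      exact (hU i).inter (isOpen_interior.inter hcl.isOpen_compl)
    · have : W (n, i) = ∅ := by
        ext y; simp [W, h]
      rw [this]
      exact isOpen_empty
  · refine eq_univ_of_forall fun y => ?_
    classical
    obtain ⟨i, hi, hyi⟩ := hFU _ y (Nat.find_spec (hFcov y))
    refine mem_iUnion.2 ⟨(Nat.find (hFcov y), i), hyi, hi, hFint _ (Nat.find_spec (hFcov y)),
      fun h => ?_⟩
    obtain ⟨k, hk, hk'⟩ := mem_iUnion₂.1 h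
    exact Nat.find_min (hFcov y) hk hk'
  · rintro ⟨n, i⟩
    refine ((finite_Iic (n + 1)).prod (finite_Iic (n + 1))).subset ?_
    rintro ⟨n', i'⟩ ⟨y, hy, hy'⟩
    have h1 : n' ≤ n + 1 := by
      by_contra hlt
      exact hy'.2.2.2 (mem_biUnion (mem_Iio.2 (not_le.1 hlt)) (interior_subset hy.2.2.1))
    exact ⟨h1, hy'.2.1.trans h1⟩

/-- Every open cover of a separable metrizable space of small inductive dimension `< n` has a
countable star-finite open refinement of order at most `n`. -/
theorem HasSmallInductiveDimensionLT.exists_refinement {Y : Type v} [TopologicalSpace Y]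
    [TopologicalSpace.MetrizableSpace Y] [SecondCountableTopology Y] [Nonempty Y] {n : ℕ}
    (h : HasSmallInductiveDimensionLT Y n) (U : Y → Set Y) (hU : ∀ y, IsOpen (U y))
    (hyU : ∀ y, y ∈ U y) :
    ∃ O : (ℕ × ℕ) × Fin n → Set Y, (∀ i, IsOpen (O i)) ∧ ⋃ i, O i = univ ∧
      (∀ i, ∃ y, O i ⊆ U y) ∧ (∀ i, {j | (O i ∩ O j).Nonempty}.Finite) ∧
      ∀ (s : Finset ((ℕ × ℕ) × Fin n)) (y : Y), (∀ i ∈ s, y ∈ O i) → s.card ≤ n := by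
  obtain ⟨T, hT, hTU⟩ := TopologicalSpace.isOpen_iUnion_countable U hU
  have hU1 : ⋃ y, U y = univ := eq_univ_of_forall fun y => mem_iUnion.2 ⟨y, hyU y⟩
  have hTne : T.Nonempty := by
    obtain ⟨y⟩ := ‹Nonempty Y›
    have : y ∈ ⋃ i ∈ T, U i := by rw [hTU, hU1]; trivial
    obtain ⟨t, ht, -⟩ := mem_iUnion₂.1 this
    exact ⟨t, ht⟩
  obtain ⟨r, hr⟩ := hT.exists_eq_range hTne
  obtain ⟨W, oW, cW, sW, fW⟩ := exists_starFinite_refinement (fun k => U (r k)) (fun k => hU _) (by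
    refine eq_univ_of_forall fun y => ?_
    have : y ∈ ⋃ i ∈ T, U i := by rw [hTU, hU1]; trivial
    obtain ⟨t, ht, hy⟩ := mem_iUnion₂.1 this
    rw [hr] at ht
    obtain ⟨k, rfl⟩ := ht
    exact mem_iUnion.2 ⟨k, hy⟩)
  obtain ⟨Z, cZ, hZ⟩ := HasSmallInductiveDimensionLT.exists_zeroDimOn_cover n Y h
  choose V oV sV cV dV using fun c => (hZ c).exists_disjoint_shrinking W oW
    (by rw [cW]; exact subset_univ _)
  refine ⟨fun i => V i.2 i.1, fun i => oV _ _, ?_, fun i => ⟨_, (sV _ _).trans (sW _)⟩, ?_, ?_⟩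
  · refine eq_univ_of_forall fun y => ?_
    obtain ⟨c, hc⟩ := mem_iUnion.1 (cZ ▸ mem_univ y)
    obtain ⟨p, hp⟩ := mem_iUnion.1 (cV c hc)
    exact mem_iUnion.2 ⟨(p, c), hp⟩
  · rintro ⟨p, c⟩
    refine ((fW p).prod (finite_univ (α := Fin n))).subset ?_
    rintro ⟨q, c'⟩ ⟨y, hy, hy'⟩
    exact ⟨⟨y, sV _ _ hy, sV _ _ hy'⟩, mem_univ _⟩
  · intro s y hs
    -- Members with the same second index are disjoint, so a point lies in at most one member for
    -- each of the `n` values.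
    have : s.card ≤ (Finset.univ : Finset (Fin n)).card := by
      refine Finset.card_le_card_of_injOn Prod.snd (fun _ _ => Finset.mem_coe.2 (Finset.mem_univ _)) ?_
      rintro ⟨p, c⟩ hp ⟨q, c'⟩ hq hcc
      obtain rfl : c = c' := hcc
      rw [dV c p q y (hs _ hp) (hs _ hq)]
    simpa using this

/-! ### Control functions in place of open covers. -/

/-- A positive `1`-Lipschitz real function. -/
def LipPos {X : Type*} [PseudoMetricSpace X] (ε : X → ℝ) : Prop :=
  (∀ x, 0 < ε x) ∧ ∀ x y, ε x ≤ ε y + dist x y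

/-- The points which are `ε`-close to a point of `S`. -/
def thick {X : Type*} [PseudoMetricSpace X] (ε : X → ℝ) (S : Set X) : Set X :=
  {y | ∃ x ∈ S, dist y x < ε x}

section LipPos

variable {X : Type*} [PseudoMetricSpace X]

theorem LipPos.min {ε ε' : X → ℝ} (h : LipPos ε) (h' : LipPos ε') :
    LipPos fun x => Min.min (ε x) (ε' x) := by
  refine ⟨fun x => lt_min (h.1 x) (h'.1 x), fun x y => ?_⟩
  rw [← min_add_add_right]
  exact min_le_min (h.2 x y) (h'.2 x y)

theorem LipPos.mul_const {ε : X → ℝ} (h : LipPos ε) {c : ℝ} (hc : 0 < c) (hc1 : c ≤ 1) :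
    LipPos fun x => c * ε x := by
  refine ⟨fun x => mul_pos hc (h.1 x), fun x y => ?_⟩
  calc c * ε x ≤ c * (ε y + dist x y) := by gcongr; exact h.2 x y
    _ = c * ε y + c * dist x y := by ring
    _ ≤ c * ε y + dist x y := by
      gcongr; exact mul_le_of_le_one_left dist_nonneg hc1

theorem lipPos_one : LipPos fun _ : X => (1 : ℝ) :=
  ⟨fun _ => one_pos, fun x y => by linarith [dist_nonneg (x := x) (y := y)]⟩

theorem LipPos.continuous {ε : X → ℝ} (h : LipPos ε) : Continuous ε :=
  (LipschitzWith.of_le_add fun x y => h.2 x y).continuous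

theorem thick_mono {ε ε' : X → ℝ} (h : ∀ x, ε x ≤ ε' x) {S S' : Set X} (hS : S ⊆ S') :
    thick ε S ⊆ thick ε' S' := fun _ ⟨x, hx, hd⟩ => ⟨x, hS hx, hd.trans_le (h x)⟩

theorem subset_thick {ε : X → ℝ} (h : ∀ x, 0 < ε x) (S : Set X) : S ⊆ thick ε S :=
  fun x hx => ⟨x, hx, by rw [dist_self]; exact h x⟩

/-- A Lebesgue function for the cover by the balls `ball x (r x)`. -/
theorem exists_lipPos_ball_subset (r : X → ℝ) (hr : ∀ x, 0 < r x) :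
    ∃ ε : X → ℝ, LipPos ε ∧ ∀ x, ∃ y, Metric.ball x (ε x) ⊆ Metric.ball y (r y) := by
  rcases isEmpty_or_nonempty X with hX | hX
  · exact ⟨fun _ => 1, lipPos_one, fun x => (hX.false x).elim⟩
  -- Truncation at `1` keeps the supremum finite; halving it below gives a value strictly exceeded
  -- by some term, so the supremum need not be attained.
  let s : X → ℝ := fun x => ⨆ y, (Min.min (r y) 1 - dist x y)
  have hbdd : ∀ x, BddAbove (range fun y => Min.min (r y) 1 - dist x y) := fun x =>
    ⟨1, by
      rintro _ ⟨y, rfl⟩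
      have := min_le_right (r y) 1
      have := dist_nonneg (x := x) (y := y)
      simp only
      linarith⟩
  have hpos : ∀ x, 0 < s x := fun x => by
    refine lt_of_lt_of_le (lt_min (hr x) one_pos) ?_
    have := le_ciSup (hbdd x) x
    simpa using this
  have hlip : ∀ x y, s x ≤ s y + dist x y := fun x y => by
    refine ciSup_le fun z => ?_
    have h1 := le_ciSup (hbdd y) z
    have h2 := dist_triangle_left y z x
    have h3 : Min.min (r z) 1 - dist y z ≤ s y := h1
    linarith
  refine ⟨fun x => (1 / 2) * s x, (show LipPos s from ⟨hpos, hlip⟩).mul_const (by norm_num)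
    (by norm_num), fun x => ?_⟩
  obtain ⟨y, hy⟩ := exists_lt_of_lt_ciSup (show (1 / 2) * s x < s x by linarith [hpos x])
  refine ⟨y, fun z hz => ?_⟩
  rw [Metric.mem_ball] at hz ⊢
  have := min_le_left (r y) 1
  linarith [dist_triangle z x y]

theorem exists_lipPos_of_isOpenCovering {𝒰 : Set (Set X)} (h : IsOpenCovering 𝒰) :
    ∃ ε : X → ℝ, LipPos ε ∧ ∀ x, ∃ U ∈ 𝒰, Metric.ball x (ε x) ⊆ U := by
  have hex : ∀ x, ∃ r > 0, ∃ U ∈ 𝒰, Metric.ball x r ⊆ U := fun x => by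
    obtain ⟨U, hU, hx⟩ := mem_sUnion.1 (h.2 ▸ mem_univ x)
    obtain ⟨r, hr, hr'⟩ := Metric.isOpen_iff.1 (h.1 U hU) x hx
    exact ⟨r, hr, U, hU, hr'⟩
  choose r hr U hU hrU using hex
  obtain ⟨ε, hε, hb⟩ := exists_lipPos_ball_subset r hr
  refine ⟨ε, hε, fun x => ?_⟩
  obtain ⟨y, hy⟩ := hb x
  exact ⟨U y, hU y, hy.trans (hrU y)⟩

theorem isOpenCovering_ball {ε : X → ℝ} (h : ∀ x, 0 < ε x) :
    IsOpenCovering {U | ∃ x, U = Metric.ball x (ε x)} :=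
  ⟨by rintro _ ⟨x, rfl⟩; exact Metric.isOpen_ball,
    eq_univ_of_forall fun x => ⟨_, ⟨x, rfl⟩, Metric.mem_ball_self (h x)⟩⟩

/-- A locally finite family of closed sets has a locally finite thickening which separates the
disjoint members of the family. -/
theorem LocallyFinite.exists_thick {ι : Type*} {C : ι → Set X} (hC : LocallyFinite C)
    (hcl : ∀ i, IsClosed (C i)) :
    ∃ ε : X → ℝ, LipPos ε ∧ LocallyFinite (fun i => thick ε (C i)) ∧
      ∀ i j, Disjoint (C i) (C j) → Disjoint (thick ε (C i)) (thick ε (C j)) := by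
  -- Around `x` only members through `x` are seen. Hence all members close to a given point share a
  -- point, which excludes two disjoint ones.
  have hex : ∀ x, ∃ r > 0, ∀ i, (C i ∩ Metric.ball x r).Nonempty → x ∈ C i := by
    intro x
    have := hC.iInter_compl_mem_nhds hcl x
    obtain ⟨r, hr, hr'⟩ := Metric.mem_nhds_iff.1 this
    refine ⟨r, hr, fun i ⟨y, hy, hyr⟩ => by_contra fun hx => ?_⟩
    exact mem_iInter₂.1 (hr' hyr) i hx hy
  choose r hr hrC using hex
  obtain ⟨ε, hε, hb⟩ := exists_lipPos_ball_subset r hr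
  have hε' := hε.mul_const (c := 1 / 4) (by norm_num) (by norm_num)
  have key : ∀ y c : X, dist y c < 1 / 4 * ε c → dist y c < 1 / 3 * ε y := fun y c h => by
    have := hε.2 c y
    rw [dist_comm] at this
    linarith
  refine ⟨fun x => 1 / 4 * ε x, hε', fun y => ?_, fun i j hij => ?_⟩
  · obtain ⟨x, hx⟩ := hb y
    refine ⟨Metric.ball y (1 / 4 * ε y), Metric.ball_mem_nhds _ (hε'.1 y),
      (hC.point_finite x).subset ?_⟩
    rintro i ⟨z, ⟨c, hc, hzc⟩, hz⟩
    refine hrC x i ⟨c, hc, hx ?_⟩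
    rw [Metric.mem_ball] at hz ⊢
    have h1 := key z c hzc
    have h2 := hε.2 z y
    have h3 := dist_triangle_left c y z
    have h4 := hε.1 y
    linarith
  · refine disjoint_left.2 ?_
    rintro y ⟨c, hc, hyc⟩ ⟨c', hc', hyc'⟩
    obtain ⟨x, hx⟩ := hb y
    have hmem : ∀ c, dist y c < 1 / 4 * ε c → c ∈ Metric.ball y (ε y) := fun c h => by
      rw [Metric.mem_ball, dist_comm]
      linarith [key y c h, hε.1 y]
    exact hij.notMem_of_mem_left (hrC x i ⟨c, hc, hx (hmem c hyc)⟩)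
      (hrC x j ⟨c', hc', hx (hmem c' hyc')⟩)

end LipPos

/-! ### Filling cubes with control. -/

/-- Maps from the boundary of the `d`-cube into `A` extend to maps of the cube into `B`. -/
def CubeFills {X : Type*} [TopologicalSpace X] (d : ℕ) (A B : Set X) : Prop :=
  ∀ q : (Fin d → ℝ) → X, ContinuousOn q (Metric.sphere 0 1) → MapsTo q (Metric.sphere 0 1) A →
    ∃ p : (Fin d → ℝ) → X, ContinuousOn p (Metric.closedBall 0 1) ∧
      EqOn p q (Metric.sphere 0 1) ∧ MapsTo p (Metric.closedBall 0 1) B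

/-- For every control function `ε` there is a control function `δ` such that maps of boundaries of
`d`-cubes into `δ`-balls extend to maps of the cubes into concentric `ε`-balls. -/
def ControlledFilling (d : ℕ) (X : Type*) [PseudoMetricSpace X] : Prop :=
  ∀ ε : X → ℝ, LipPos ε → ∃ δ : X → ℝ, LipPos δ ∧ (∀ x, δ x ≤ ε x) ∧
    ∀ x, CubeFills d (Metric.ball x (δ x)) (Metric.ball x (ε x))

theorem CubeFills.mono {X : Type*} [TopologicalSpace X] {d : ℕ} {A A' B B' : Set X}
    (h : CubeFills d A B) (hA : A' ⊆ A) (hB : B ⊆ B') : CubeFills d A' B' := by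
  intro q hq hqA
  obtain ⟨p, h1, h2, h3⟩ := h q hq (hqA.mono_right hA)
  exact ⟨p, h1, h2, h3.mono_right hB⟩

theorem cubeFills_zero {X : Type*} [TopologicalSpace X] {A B : Set X} (h : B.Nonempty) :
    CubeFills 0 A B := by
  intro q _ _
  obtain ⟨x, hx⟩ := h
  refine ⟨fun _ => x, continuousOn_const, fun z hz => ?_, fun _ _ => hx⟩
  rw [Subsingleton.elim z 0, mem_sphere_zero_iff_norm, norm_zero] at hz
  exact (zero_ne_one hz).elim

/-- Local connectedness speaks of Euclidean balls, the cells below are cubes. Both are bounded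
convex bodies with nonempty interior, hence homeomorphic by a map respecting boundaries. -/
theorem exists_homeomorph_cube_ball (k : ℕ) :
    ∃ h : (Fin (k + 1) → ℝ) ≃ₜ EuclideanSpace ℝ (Fin (k + 1)),
      h '' Metric.closedBall 0 1 = Metric.closedBall 0 1 ∧
      h '' Metric.sphere 0 1 = Metric.sphere 0 1 := by
  let e : EuclideanSpace ℝ (Fin (k + 1)) ≃L[ℝ] (Fin (k + 1) → ℝ) :=
    EuclideanSpace.equiv (Fin (k + 1)) ℝ
  let s : Set (EuclideanSpace ℝ (Fin (k + 1))) := e ⁻¹' Metric.closedBall 0 1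
  have hfr : frontier s = e ⁻¹' Metric.sphere 0 1 := by
    rw [← frontier_closedBall (0 : Fin (k + 1) → ℝ) one_ne_zero]
    exact (e.toHomeomorph.preimage_frontier _).symm
  have hcl : closure s = s := (Metric.isClosed_closedBall.preimage e.continuous).closure_eq
  have hs : s = e.symm '' Metric.closedBall 0 1 := (e.symm.image_eq_preimage_symm _).symm
  obtain ⟨h, -, h2, h3⟩ := exists_homeomorph_image_interior_closure_frontier_eq_unitBall (s := s)
    ((convex_closedBall (0 : Fin (k + 1) → ℝ) 1).is_linear_preimage e.toLinearMap.isLinear)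
    ⟨0, mem_interior_iff_mem_nhds.2 (e.continuous.continuousAt.preimage_mem_nhds (by
      rw [map_zero]; exact Metric.closedBall_mem_nhds _ one_pos))⟩
    (by
      rw [hs]
      exact ((isCompact_closedBall _ _).image e.symm.continuous).isBounded)
  refine ⟨e.symm.toHomeomorph.trans h, ?_, ?_⟩
  · rw [← h2, hcl, hs, image_image]; rfl
  · have hs' : e ⁻¹' Metric.sphere 0 1 = e.symm '' Metric.sphere 0 1 :=
      (e.symm.image_eq_preimage_symm _).symm
    rw [← h3, hfr, hs', image_image]; rfl

theorem LocallyKConnected.cubeFills {X : Type*} [TopologicalSpace X] {k : ℕ}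
    (h : LocallyKConnected k X) (x : X) {U : Set X} (hU : U ∈ 𝓝 x) :
    ∃ V ∈ 𝓝 x, V ⊆ U ∧ CubeFills (k + 1) V U := by
  obtain ⟨V, hV, hVU, hfill⟩ := h x U hU
  refine ⟨V, hV, hVU, fun q hq hqV => ?_⟩
  obtain ⟨Φ, hΦ, hΦ'⟩ := exists_homeomorph_cube_ball k
  have hsph : ∀ s ∈ Metric.sphere (0 : EuclideanSpace ℝ (Fin (k + 1))) 1,
      Φ.symm s ∈ Metric.sphere (0 : Fin (k + 1) → ℝ) 1 := fun s hs => by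
    rw [← hΦ'] at hs
    obtain ⟨z, hz, rfl⟩ := hs
    simpa using hz
  have hball : ∀ z ∈ Metric.closedBall (0 : Fin (k + 1) → ℝ) 1,
      Φ z ∈ Metric.closedBall (0 : EuclideanSpace ℝ (Fin (k + 1))) 1 := fun z hz => by
    rw [← hΦ]; exact mem_image_of_mem _ hz
  have hsph' : ∀ z ∈ Metric.sphere (0 : Fin (k + 1) → ℝ) 1,
      Φ z ∈ Metric.sphere (0 : EuclideanSpace ℝ (Fin (k + 1))) 1 := fun z hz => by
    rw [← hΦ']; exact mem_image_of_mem _ hz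
  obtain ⟨F, hFU, hF⟩ := hfill ⟨fun s => q (Φ.symm s),
    hq.comp_continuous (Φ.symm.continuous.comp continuous_subtype_val) fun s => hsph s s.2⟩
    (fun s => hqV (hsph s s.2))
  classical
  refine ⟨fun z => if hz : z ∈ Metric.closedBall (0 : Fin (k + 1) → ℝ) 1 then
    F ⟨Φ z, hball z hz⟩ else q z, ?_, ?_, ?_⟩
  · rw [continuousOn_iff_continuous_domRestrict]
    have : (Metric.closedBall (0 : Fin (k + 1) → ℝ) 1).domRestrict
        (fun z => if hz : z ∈ Metric.closedBall (0 : Fin (k + 1) → ℝ) 1 then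
          F ⟨Φ z, hball z hz⟩ else q z) =
        fun z : Metric.closedBall (0 : Fin (k + 1) → ℝ) 1 => F ⟨Φ z.1, hball z.1 z.2⟩ := by
      ext ⟨z, hz⟩
      simp only [domRestrict_apply, dif_pos hz]
    rw [this]
    exact F.continuous.comp ((Φ.continuous.comp continuous_subtype_val).subtype_mk _)
  · intro z hz
    have hz' := Metric.sphere_subset_closedBall hz
    simp only [dif_pos hz']
    have := hF ⟨Φ z, hsph' z hz⟩
    simpa using this
  · intro z hz
    simp only [dif_pos hz]
    exact hFU _

/-- A Lebesgue function for the locally chosen radii makes the pointwise filling condition uniform: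
the `δ`-ball at `x` lies in a good ball at some `y`, and the `ε y / 4`-ball at `y` lies in the
`ε`-ball at `x`. -/
theorem controlledFilling_of_locallyKConnected {X : Type*} [PseudoMetricSpace X] {d : ℕ}
    (h : ∀ k, k + 1 = d → LocallyKConnected k X) : ControlledFilling d X := by
  intro ε hε
  cases d with
  | zero =>
    exact ⟨ε, hε, fun _ => le_rfl, fun x => cubeFills_zero ⟨x, Metric.mem_ball_self (hε.1 x)⟩⟩
  | succ k =>
    have hex : ∀ x, ∃ r > 0, r ≤ 1 / 4 * ε x ∧
        CubeFills (k + 1) (Metric.ball x r) (Metric.ball x (1 / 4 * ε x)) := fun x => by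
      have h0 : 0 < 1 / 4 * ε x := by linarith [hε.1 x]
      obtain ⟨V, hV, -, hf⟩ := (h k rfl).cubeFills x (Metric.ball_mem_nhds x h0)
      obtain ⟨r, hr, hrV⟩ := Metric.mem_nhds_iff.1 hV
      exact ⟨Min.min r (1 / 4 * ε x), lt_min hr h0, min_le_right _ _,
        hf.mono ((Metric.ball_subset_ball (min_le_left _ _)).trans hrV) subset_rfl⟩
    choose r hr hr' hf using hex
    obtain ⟨δ, hδ, hb⟩ := exists_lipPos_ball_subset r hr
    refine ⟨fun x => Min.min (δ x) (ε x), hδ.min hε, fun x => min_le_right _ _, fun x => ?_⟩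
    obtain ⟨y, hy⟩ := hb x
    refine (hf y).mono ((Metric.ball_subset_ball (min_le_left _ _)).trans hy) ?_
    intro z hz
    have hx : x ∈ Metric.ball y (r y) := hy (Metric.mem_ball_self (hδ.1 x))
    rw [Metric.mem_ball] at hx hz ⊢
    have h1 := hε.2 y x
    rw [dist_comm] at h1
    have h2 := hr' y
    have h3 := dist_triangle_right z x y
    have h4 := hε.1 y
    linarith

/-! ### The integer cubical grid. -/

/-- A cell of the integer cubical grid in `V → ℝ`: the coordinates in `free` range over an
interval `[l v, l v + 1]`, the other ones are equal to `l v`. -/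
structure GridCell (V : Type*) where
  corner : V → ℤ
  free : Finset V

namespace GridCell

variable {V : Type*} {s t c : GridCell V} {x : V → ℝ}

theorem ext' (h : s.corner = t.corner) (h' : s.free = t.free) : s = t := by
  cases s; cases t; simp_all

/-- The closed cell. -/
def carrier (c : GridCell V) : Set (V → ℝ) :=
  {x | ∀ v, (v ∈ c.free → (c.corner v : ℝ) ≤ x v ∧ x v ≤ c.corner v + 1) ∧
    (v ∉ c.free → x v = c.corner v)}

/-- The open cell. -/
def inner (c : GridCell V) : Set (V → ℝ) :=
  {x | ∀ v, (v ∈ c.free → (c.corner v : ℝ) < x v ∧ x v < c.corner v + 1) ∧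
    (v ∉ c.free → x v = c.corner v)}

/-- The boundary of a cell. -/
def bdry (c : GridCell V) : Set (V → ℝ) := c.carrier \ c.inner

/-- The dimension of a cell. -/
def dim (c : GridCell V) : ℕ := c.free.card

theorem inner_subset_carrier (c : GridCell V) : c.inner ⊆ c.carrier :=
  fun _ hx v => ⟨fun hv => ⟨((hx v).1 hv).1.le, ((hx v).1 hv).2.le⟩, (hx v).2⟩

theorem bdry_subset_carrier (c : GridCell V) : c.bdry ⊆ c.carrier := sdiff_subset

theorem isClosed_carrier (c : GridCell V) : IsClosed c.carrier := by
  have : c.carrier = (⋂ v, ⋂ _ : v ∈ c.free,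
        {x : V → ℝ | (c.corner v : ℝ) ≤ x v ∧ x v ≤ (c.corner v : ℝ) + 1}) ∩
      ⋂ v, ⋂ _ : v ∉ c.free, {x : V → ℝ | x v = (c.corner v : ℝ)} := by
    ext x
    simp only [carrier, mem_ofPred_eq, mem_inter_iff, mem_iInter, forall_and]
  rw [this]
  refine IsClosed.inter ?_ ?_
  · exact isClosed_iInter fun v => isClosed_iInter fun _ =>
      (isClosed_le continuous_const (continuous_apply v)).inter
        (isClosed_le (continuous_apply v) continuous_const)
  · exact isClosed_iInter fun v => isClosed_iInter fun _ =>
      isClosed_eq (continuous_apply v) continuous_const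

theorem inner_nonempty (c : GridCell V) : c.inner.Nonempty := by
  classical
  refine ⟨fun v => if v ∈ c.free then c.corner v + 1 / 2 else c.corner v, fun v => ?_⟩
  constructor
  · intro hv
    simp only [if_pos hv]
    constructor <;> linarith
  · intro hv
    simp only [if_neg hv]

/-- A coordinate that is free in `s` is strictly between consecutive integers at `x`, so it cannot
be one of the integral coordinates fixed by `t`. -/
theorem free_subset_of_inner (hs : x ∈ s.inner) (ht : x ∈ t.carrier) : s.free ⊆ t.free := by
  intro v hv
  by_contra hv'
  have h1 := (hs v).1 hv
  rw [(ht v).2 hv'] at h1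
  have h2 : s.corner v < t.corner v := by exact_mod_cast h1.1
  have h3 : t.corner v < s.corner v + 1 := by exact_mod_cast h1.2
  omega

theorem corner_eq_of_inner (hs : x ∈ s.inner) (ht : x ∈ t.carrier) {v : V} (hv : v ∈ s.free) :
    s.corner v = t.corner v := by
  have h1 := (hs v).1 hv
  have h2 := (ht v).1 (free_subset_of_inner hs ht hv)
  have h3 : (s.corner v : ℝ) < t.corner v + 1 := h1.1.trans_le h2.2
  have h4 : (t.corner v : ℝ) < s.corner v + 1 := h2.1.trans_lt h1.2
  have h5 : s.corner v < t.corner v + 1 := by exact_mod_cast h3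
  have h6 : t.corner v < s.corner v + 1 := by exact_mod_cast h4
  omega

/-- The face relation is detected by a single point of the open cell, which is what makes families
of cells behave as complexes. -/
theorem carrier_subset_of_inner (hs : x ∈ s.inner) (ht : x ∈ t.carrier) :
    s.carrier ⊆ t.carrier := by
  intro y hy v
  by_cases hv : v ∈ s.free
  · have hvt := free_subset_of_inner hs ht hv
    refine ⟨fun _ => ?_, fun h => (h hvt).elim⟩
    rw [← corner_eq_of_inner hs ht hv]
    exact (hy v).1 hv
  · rw [(hy v).2 hv, ← (hs v).2 hv]
    exact ht v

theorem dim_le_of_inner (hs : x ∈ s.inner) (ht : x ∈ t.carrier) : s.dim ≤ t.dim :=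
  Finset.card_le_card (free_subset_of_inner hs ht)

theorem eq_of_inner_of_dim_le (hs : x ∈ s.inner) (ht : x ∈ t.carrier) (h : t.dim ≤ s.dim) :
    s = t := by
  have hf : s.free = t.free := Finset.eq_of_subset_of_card_le (free_subset_of_inner hs ht) h
  refine ext' (funext fun v => ?_) hf
  by_cases hv : v ∈ s.free
  · exact corner_eq_of_inner hs ht hv
  · have h1 := (hs v).2 hv
    rw [(ht v).2 (hf ▸ hv)] at h1
    exact_mod_cast h1.symm

/-- Every point of a cell is in the interior of a face. -/
theorem exists_inner (ht : x ∈ t.carrier) : ∃ s : GridCell V, x ∈ s.inner := by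
  classical
  refine ⟨⟨fun v => ⌊x v⌋, t.free.filter fun v => (⌊x v⌋ : ℝ) < x v⟩, fun v => ?_⟩
  simp only [Finset.mem_filter]
  refine ⟨fun hv => ⟨hv.2, Int.lt_floor_add_one _⟩, fun hv => ?_⟩
  by_cases hvt : v ∈ t.free
  · exact le_antisymm (not_lt.1 fun h => hv ⟨hvt, h⟩) (Int.floor_le _)
  · rw [(ht v).2 hvt, Int.floor_intCast]

theorem exists_inner_of_bdry (ht : x ∈ t.bdry) :
    ∃ s : GridCell V, x ∈ s.inner ∧ s.carrier ⊆ t.carrier ∧ s.dim < t.dim := by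
  obtain ⟨s, hs⟩ := exists_inner ht.1
  refine ⟨s, hs, carrier_subset_of_inner hs ht.1, lt_of_not_ge fun h => ?_⟩
  exact ht.2 (eq_of_inner_of_dim_le hs ht.1 h ▸ hs)

open Classical in
/-- The facet of `c` on which the free coordinate `v` is maximal or minimal. -/
noncomputable def facet (c : GridCell V) (v : V) (top : Bool) : GridCell V :=
  ⟨Function.update c.corner v (if top then c.corner v + 1 else c.corner v), c.free.erase v⟩

theorem dim_facet_lt {v : V} (hv : v ∈ c.free) (i : Bool) : (c.facet v i).dim < c.dim := by
  classical
  exact Finset.card_lt_card (Finset.erase_ssubset hv)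

theorem mem_facet_iff {v : V} (hv : v ∈ c.free) (i : Bool) :
    x ∈ (c.facet v i).carrier ↔
      x ∈ c.carrier ∧ x v = if i then (c.corner v : ℝ) + 1 else c.corner v := by
  classical
  have hup : ∀ w, w ≠ v → (c.facet v i).corner w = c.corner w := fun w hw =>
    Function.update_of_ne hw _ _
  have hupv : ((c.facet v i).corner v : ℝ) = if i then (c.corner v : ℝ) + 1 else c.corner v := by
    simp only [facet, Function.update_self]
    split_ifs <;> push_cast <;> rfl
  have hfree : ∀ w, w ∈ (c.facet v i).free ↔ w ≠ v ∧ w ∈ c.free := fun w => by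
    simp only [facet, Finset.mem_erase]
  constructor
  · intro hx
    have hxv : x v = if i then (c.corner v : ℝ) + 1 else c.corner v := by
      rw [(hx v).2 (by rw [hfree]; exact fun h => h.1 rfl), hupv]
    refine ⟨fun w => ?_, hxv⟩
    by_cases hw : w = v
    · subst hw
      refine ⟨fun _ => ?_, fun h => (h hv).elim⟩
      rw [hxv]
      split_ifs <;> constructor <;> linarith
    · have := hx w
      rw [hup w hw, hfree] at this
      exact ⟨fun h => this.1 ⟨hw, h⟩, fun h => this.2 fun h' => h h'.2⟩
  · rintro ⟨hx, hxv⟩ w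
    by_cases hw : w = v
    · subst hw
      rw [hfree, hupv]
      exact ⟨fun h => (h.1 rfl).elim, fun _ => hxv⟩
    · rw [hup w hw, hfree]
      exact ⟨fun h => (hx w).1 h.2, fun h => (hx w).2 fun h' => h ⟨hw, h'⟩⟩

theorem bdry_eq_iUnion_facet (c : GridCell V) :
    c.bdry = ⋃ p : {v // v ∈ c.free} × Bool, (c.facet p.1 p.2).carrier := by
  ext x
  simp only [mem_iUnion, Prod.exists, Subtype.exists]
  constructor
  · rintro ⟨hx, hx'⟩
    by_contra! hn
    refine hx' fun v => ⟨fun hv => ?_, (hx v).2⟩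
    have h1 := (hx v).1 hv
    refine ⟨lt_of_le_of_ne h1.1 fun h => ?_, lt_of_le_of_ne h1.2 fun h => ?_⟩
    · exact hn v hv false ((mem_facet_iff hv false).2 ⟨hx, by simpa using h.symm⟩)
    · exact hn v hv true ((mem_facet_iff hv true).2 ⟨hx, by simpa using h⟩)
  · rintro ⟨v, hv, i, hx⟩
    rw [mem_facet_iff hv] at hx
    refine ⟨hx.1, fun h => ?_⟩
    have h1 := (h v).1 hv
    rw [hx.2] at h1
    split_ifs at h1
    · exact lt_irrefl _ h1.2
    · exact lt_irrefl _ h1.1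

theorem facet_subset {v : V} (hv : v ∈ c.free) (i : Bool) :
    (c.facet v i).carrier ⊆ c.carrier := fun _ hx => ((mem_facet_iff hv i).1 hx).1

theorem continuousOn_bdry {X : Type*} [TopologicalSpace X] {q : (V → ℝ) → X}
    (h : ∀ s : GridCell V, s.carrier ⊆ c.carrier → s.dim < c.dim → ContinuousOn q s.carrier) :
    ContinuousOn q c.bdry := by
  rw [bdry_eq_iUnion_facet]
  exact (locallyFinite_of_finite _).continuousOn_iUnion (fun p => isClosed_carrier _)
    fun p => h _ (facet_subset p.1.2 _) (dim_facet_lt p.1.2 _)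

/-- Coordinates identifying a cell with a cube. -/
theorem exists_coordinates (c : GridCell V) {d : ℕ} (hd : c.dim = d) :
    ∃ (κ : (V → ℝ) → (Fin d → ℝ)) (π : (Fin d → ℝ) → (V → ℝ)), Continuous κ ∧ Continuous π ∧
      (∀ x ∈ c.carrier, κ x ∈ Metric.closedBall 0 1 ∧ π (κ x) = x) ∧
      (∀ z ∈ Metric.closedBall 0 1, π z ∈ c.carrier ∧ κ (π z) = z) ∧
      ∀ x ∈ c.carrier, κ x ∈ Metric.sphere 0 1 ↔ x ∈ c.bdry := by
  classical
  let e : Fin d ≃ {v // v ∈ c.free} := (c.free.equivFinOfCardEq hd).symm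
  let κ : (V → ℝ) → (Fin d → ℝ) := fun x i => 2 * (x (e i) - c.corner (e i)) - 1
  let π : (Fin d → ℝ) → (V → ℝ) := fun z v =>
    if h : v ∈ c.free then c.corner v + (z (e.symm ⟨v, h⟩) + 1) / 2 else c.corner v
  have hπ : ∀ z v (h : v ∈ c.free), π z v = c.corner v + (z (e.symm ⟨v, h⟩) + 1) / 2 :=
    fun z v h => dif_pos h
  have hπ' : ∀ z v, v ∉ c.free → π z v = c.corner v := fun z v h => dif_neg h
  have hball : ∀ z : Fin d → ℝ, z ∈ Metric.closedBall (0 : Fin d → ℝ) 1 ↔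
      ∀ i, -1 ≤ z i ∧ z i ≤ 1 := fun z => by
    rw [mem_closedBall_zero_iff, pi_norm_le_iff_of_nonneg zero_le_one]
    simp only [Real.norm_eq_abs, abs_le]
  have hκball : ∀ x ∈ c.carrier, κ x ∈ Metric.closedBall 0 1 := fun x hx => by
    rw [hball]
    intro i
    have := (hx (e i)).1 (e i).2
    simp only [κ]
    constructor <;> linarith
  refine ⟨κ, π, by fun_prop, ?_, fun x hx => ⟨hκball x hx, ?_⟩, fun z hz => ⟨?_, ?_⟩,
    fun x hx => ?_⟩
  · refine continuous_pi fun v => ?_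
    by_cases h : v ∈ c.free
    · simp only [hπ _ v h]; fun_prop
    · simp only [hπ' _ v h]; fun_prop
  · ext v
    by_cases h : v ∈ c.free
    · rw [hπ _ v h]
      simp only [κ, Equiv.apply_symm_apply]
      ring
    · rw [hπ' _ v h, (hx v).2 h]
  · intro v
    rw [hball] at hz
    refine ⟨fun h => ?_, fun h => hπ' z v h⟩
    rw [hπ _ v h]
    have := hz (e.symm ⟨v, h⟩)
    constructor <;> linarith
  · ext i
    simp only [κ]
    rw [hπ _ _ (e i).2]
    simp only [Subtype.coe_eta, Equiv.symm_apply_apply]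
    ring
  · have hle := mem_closedBall_zero_iff.1 (hκball x hx)
    have hlt : ‖κ x‖ < 1 ↔ x ∈ c.inner := by
      rw [pi_norm_lt_iff one_pos]
      simp only [Real.norm_eq_abs, abs_lt, κ]
      constructor
      · intro h v
        refine ⟨fun hv => ?_, (hx v).2⟩
        have := h (e.symm ⟨v, hv⟩)
        simp only [Equiv.apply_symm_apply] at this
        constructor <;> linarith
      · intro h i
        have := (h (e i)).1 (e i).2
        constructor <;> linarith
    rw [mem_sphere_zero_iff_norm]
    constructor
    · intro h
      refine ⟨hx, fun h' => ?_⟩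
      rw [← hlt] at h'
      exact h'.ne h
    · intro h
      refine le_antisymm hle (not_lt.1 fun h' => h.2 (hlt.1 h'))

theorem isCompact_carrier (c : GridCell V) : IsCompact c.carrier := by
  obtain ⟨κ, π, -, hπ, h1, h2, -⟩ := c.exists_coordinates rfl
  have : c.carrier = π '' Metric.closedBall 0 1 := by
    ext x
    constructor
    · exact fun hx => ⟨κ x, (h1 x hx).1, (h1 x hx).2⟩
    · rintro ⟨z, hz, rfl⟩
      exact (h2 z hz).1
  rw [this]
  exact (isCompact_closedBall _ _).image hπ

theorem _root_.CubeFills.gridCell {X : Type*} [TopologicalSpace X] {A B : Set X}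
    (h : CubeFills c.dim A B) {q : (V → ℝ) → X} (hq : ContinuousOn q c.bdry)
    (hA : MapsTo q c.bdry A) :
    ∃ p : (V → ℝ) → X, ContinuousOn p c.carrier ∧ EqOn p q c.bdry ∧ MapsTo p c.carrier B := by
  obtain ⟨κ, π, hκ, hπ, h1, h2, h3⟩ := c.exists_coordinates rfl
  have hsph : MapsTo π (Metric.sphere 0 1) c.bdry := fun z hz => by
    have hz' := h2 z (Metric.sphere_subset_closedBall hz)
    rw [← h3 _ hz'.1, hz'.2]
    exact hz
  obtain ⟨p, hp, hpq, hpB⟩ := h (q ∘ π) (hq.comp hπ.continuousOn hsph) (hA.comp hsph)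
  refine ⟨p ∘ κ, hp.comp hκ.continuousOn fun x hx => (h1 x hx).1, fun x hx => ?_,
    fun x hx => hpB (h1 x hx).1⟩
  have := hpq ((h3 x hx.1).2 hx)
  simp only [Function.comp_apply] at this ⊢
  rw [this, (h1 x hx.1).2]

/-- Redefining a map on all cells of a set of cells of the same dimension, without changing it
on their boundaries. -/
theorem exists_glue {X : Type*} (S : Set (GridCell V)) (d : ℕ) (hS : ∀ s ∈ S, s.dim = d)
    (q : (V → ℝ) → X) (p : GridCell V → (V → ℝ) → X) (hp : ∀ s ∈ S, EqOn (p s) q s.bdry) :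
    ∃ q' : (V → ℝ) → X, (∀ x, (∀ s ∈ S, x ∉ s.inner) → q' x = q x) ∧
      ∀ s ∈ S, EqOn q' (p s) s.carrier := by
  classical
  -- The choice of `s` is harmless: open cells of equal dimension are disjoint. On boundaries, where
  -- no open cell of `S` contains the point, `p s` and `q` agree.
  refine ⟨fun x => if h : ∃ s ∈ S, x ∈ s.inner then p h.choose x else q x, fun x hx => ?_,
    fun s hs x hx => ?_⟩
  · exact dif_neg fun ⟨s, hs, hx'⟩ => hx s hs hx'
  · by_cases h : ∃ s ∈ S, x ∈ s.inner
    · simp only [dif_pos h]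
      have h1 := h.choose_spec
      rw [eq_of_inner_of_dim_le h1.2 hx (by rw [hS _ h1.1, hS _ hs])]
    · simp only [dif_neg h]
      exact (hp s hs ⟨hx, fun hx' => h ⟨s, hs, hx'⟩⟩).symm

end GridCell

/-! ### Extension over subcomplexes and collars. -/

/-- Extension of a map which is close to `b` from a subcomplex `L` to a cubical complex `G` on the
cells of which `b` has small oscillation. -/
theorem GridCell.exists_extension {X : Type*} [PseudoMetricSpace X] {V : Type*} (e : ℕ)
    (hX : ∀ k < e, ControlledFilling k X) (ε : X → ℝ) (hε : LipPos ε) :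
    ∃ δ : X → ℝ, LipPos δ ∧ (∀ x, δ x ≤ ε x) ∧ ∀ (G L : Set (GridCell V)) (b h : (V → ℝ) → X),
      (∀ t ∈ G, ∀ s : GridCell V, s.carrier ⊆ t.carrier → s ∈ G) →
      (∀ t ∈ L, ∀ s : GridCell V, s.carrier ⊆ t.carrier → s ∈ L) →
      (∀ c ∈ L, ContinuousOn h c.carrier) →
      (∀ c ∈ L, ∀ x ∈ c.carrier, dist (h x) (b x) < δ (b x)) →
      (∀ c ∈ G, ∀ x ∈ c.carrier, ∀ y ∈ c.carrier, dist (b x) (b y) < δ (b x)) →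
      ∃ H : (V → ℝ) → X, (∀ c ∈ L, EqOn H h c.carrier) ∧
        (∀ c ∈ G, c.dim < e → ContinuousOn H c.carrier) ∧
        ∀ c ∈ G, c.dim < e → ∀ x ∈ c.carrier, dist (H x) (b x) < ε (b x) := by
  induction e generalizing ε with
  | zero =>
    exact ⟨ε, hε, fun _ => le_rfl, fun G L b h _ _ _ _ _ =>
      ⟨h, fun c _ => eqOn_refl _ _, by simp, by simp⟩⟩
  | succ e ih =>
    -- The filling is done in a ball centred at `b x` for a single point `x` of the cell. The
    -- factors 1/4 absorb the change of centre from `b y` to `b x` and back, and the variation of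
    -- the control functions.
    have hε1 := hε.mul_const (c := 1 / 4) (by norm_num) (by norm_num)
    obtain ⟨δ₁, hδ₁, hδ₁ε, hfill⟩ := hX e (Nat.lt_succ_self e) _ hε1
    have hε2 := hδ₁.mul_const (c := 1 / 4) (by norm_num) (by norm_num)
    obtain ⟨δ, hδ, hδε, hH⟩ := ih (fun k hk => hX k (hk.trans (Nat.lt_succ_self e))) _ hε2
    refine ⟨δ, hδ, fun x => ?_, fun G L b h hG hL hc hd hosc => ?_⟩
    · linarith [hδε x, hδ₁ε x, hε.1 x, hδ₁.1 x]
    obtain ⟨H, hHL, hHc, hHd⟩ := hH G L b h hG hL hc hd hosc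
    let S : Set (GridCell V) := {c | c ∈ G ∧ c.dim = e ∧ c ∉ L}
    have hex : ∀ c ∈ S, ∃ p : (V → ℝ) → X, ContinuousOn p c.carrier ∧ EqOn p H c.bdry ∧
        ∀ y ∈ c.carrier, dist (p y) (b y) < ε (b y) := by
      rintro c ⟨hcG, hce, -⟩
      obtain ⟨x, hx⟩ := c.inner_nonempty
      have hx := c.inner_subset_carrier hx
      obtain ⟨p, hp, hpq, hpB⟩ := CubeFills.gridCell (c := c) (q := H) (by
          rw [hce]; exact hfill (b x))
        (GridCell.continuousOn_bdry fun s hs hsd => hHc s (hG c hcG s hs) (hce ▸ hsd))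
        (by
          intro y hy
          obtain ⟨s, hys, hs, hsd⟩ := GridCell.exists_inner_of_bdry hy
          have h1 := hHd s (hG c hcG s hs) (hce ▸ hsd) y (s.inner_subset_carrier hys)
          have h2 := hosc c hcG x hx y hy.1
          have h3 := hε2.2 (b y) (b x)
          rw [dist_comm] at h3
          have h4 := hδε (b x)
          have h5 := hδ₁.1 (b x)
          have h6 := dist_triangle_right (H y) (b x) (b y)
          rw [Metric.mem_ball]
          linarith)
      refine ⟨p, hp, hpq, fun y hy => ?_⟩
      have h1 := Metric.mem_ball.1 (hpB hy)
      have h2 := hosc c hcG y hy x hx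
      have h3 := hε1.2 (b x) (b y)
      rw [dist_comm] at h3
      have h4 := hδε (b y)
      have h5 := hδ₁ε (b y)
      have h6 := dist_triangle_right (p y) (b y) (b x)
      have h7 := hε.1 (b y)
      have h8 := hδ₁.1 (b y)
      linarith
    have : Nonempty X := ⟨b 0⟩
    choose! p hp hpq hpd using hex
    obtain ⟨H', hH', hH'p⟩ := GridCell.exists_glue S e (fun c hc => hc.2.1) H p hpq
    have hold : ∀ t, (t ∈ L ∨ t.dim < e) → EqOn H' H t.carrier := by
      intro t ht x hx
      refine hH' x fun s hs hxs => ?_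
      rcases ht with ht | ht
      · exact hs.2.2 (hL t ht s (GridCell.carrier_subset_of_inner hxs hx))
      · have := GridCell.dim_le_of_inner hxs hx
        rw [hs.2.1] at this
        omega
    have hcases : ∀ c ∈ G, c.dim < e + 1 → c.dim < e ∨ c ∈ S ∨ c ∈ L := by
      intro c hcG hcd
      by_cases h1 : c.dim < e
      · exact Or.inl h1
      · by_cases h2 : c ∈ L
        · exact Or.inr (Or.inr h2)
        · exact Or.inr (Or.inl ⟨hcG, by omega, h2⟩)
    refine ⟨H', fun c hcL => (hold c (Or.inl hcL)).trans (hHL c hcL), fun c hcG hcd => ?_,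
      fun c hcG hcd x hx => ?_⟩
    · rcases hcases c hcG hcd with h1 | h1 | h1
      · exact (hHc c hcG h1).congr (hold c (Or.inr h1))
      · exact (hp c h1).congr (hH'p c h1)
      · exact (hc c h1).congr ((hold c (Or.inl h1)).trans (hHL c h1))
    · rcases hcases c hcG hcd with h1 | h1 | h1
      · rw [hold c (Or.inr h1) hx]
        have := hHd c hcG h1 x hx
        linarith [hδ₁ε (b x), hδ₁.1 (b x), hε.1 (b x)]
      · rw [hH'p c h1 hx]
        exact hpd c h1 x hx
      · rw [hold c (Or.inl h1) hx, hHL c h1 hx]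
        have := hd c h1 x hx
        linarith [hδε (b x), hδ₁ε (b x), hδ₁.1 (b x), hε.1 (b x)]

namespace GridCell

variable {d : ℕ}

/-- Sup-norm balls of integer radius are bounded by grid hyperplanes and hence are subcomplexes. The
same holds for spheres in the next lemma: a coordinate equal to `N` or `-N` is integral, so it is
constant on the cell. -/
theorem carrier_subset_closedBall {s : GridCell (Fin d)} {x : Fin d → ℝ} {N : ℕ}
    (hs : x ∈ s.inner) (hx : x ∈ Metric.closedBall 0 (N : ℝ)) :
    s.carrier ⊆ Metric.closedBall 0 (N : ℝ) := by
  intro y hy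
  rw [mem_closedBall_zero_iff, pi_norm_le_iff_of_nonneg (Nat.cast_nonneg N)] at hx ⊢
  intro v
  have hxv := hx v
  rw [Real.norm_eq_abs, abs_le] at hxv ⊢
  by_cases hv : v ∈ s.free
  · have h1 := (hs v).1 hv
    have h2 := (hy v).1 hv
    have h3 : (s.corner v : ℝ) < N := h1.1.trans_le hxv.2
    have h4 : (-(N : ℝ)) < s.corner v + 1 := hxv.1.trans_lt h1.2
    have h5 : s.corner v < N := by exact_mod_cast h3
    have h6 : -(N : ℤ) < s.corner v + 1 := by exact_mod_cast h4
    have h7 : s.corner v + 1 ≤ (N : ℤ) := by omega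
    have h8 : -(N : ℤ) ≤ s.corner v := by omega
    have h9 : (s.corner v : ℝ) + 1 ≤ N := by exact_mod_cast h7
    have h10 : -(N : ℝ) ≤ s.corner v := by exact_mod_cast h8
    exact ⟨h10.trans h2.1, h2.2.trans h9⟩
  · rw [(hy v).2 hv, ← (hs v).2 hv]
    exact hxv

theorem carrier_subset_sphere {s : GridCell (Fin d)} {x : Fin d → ℝ} {N : ℕ} (hN : 0 < N)
    (hs : x ∈ s.inner) (hx : x ∈ Metric.sphere 0 (N : ℝ)) :
    s.carrier ⊆ Metric.sphere 0 (N : ℝ) := by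
  intro y hy
  have hy1 := carrier_subset_closedBall hs (Metric.sphere_subset_closedBall hx) hy
  rw [mem_closedBall_zero_iff] at hy1
  rw [mem_sphere_zero_iff_norm] at hx ⊢
  refine le_antisymm hy1 ?_
  obtain ⟨v, hv⟩ : ∃ v, (N : ℝ) ≤ ‖x v‖ := by
    by_contra! h
    have := (pi_norm_lt_iff (x := x) (r := (N : ℝ)) (by exact_mod_cast hN)).2 h
    exact this.ne hx
  refine le_trans ?_ (norm_le_pi_norm y v)
  by_cases hvs : v ∈ s.free
  · exfalso
    have h0 := (norm_le_pi_norm x v).trans hx.le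
    have h1 := (hs v).1 hvs
    have heq : |x v| = N := le_antisymm h0 hv
    rcases (abs_eq (Nat.cast_nonneg N)).1 heq with h | h
    · rw [h] at h1
      have h3 : s.corner v < (N : ℤ) := by exact_mod_cast h1.1
      have h4 : (N : ℤ) < s.corner v + 1 := by exact_mod_cast h1.2
      omega
    · rw [h] at h1
      have h3 : s.corner v < -(N : ℤ) := by exact_mod_cast h1.1
      have h4 : -(N : ℤ) < s.corner v + 1 := by exact_mod_cast h1.2
      omega
  · rw [(hy v).2 hvs, ← (hs v).2 hvs]
    exact hv

theorem finite_carrier_subset_closedBall (N : ℕ) :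
    {s : GridCell (Fin d) | s.carrier ⊆ Metric.closedBall 0 (N : ℝ)}.Finite := by
  have hf : {l : Fin d → ℤ | ∀ v, l v ∈ Icc (-(N : ℤ)) N}.Finite :=
    Set.Finite.pi' fun _ => finite_Icc _ _
  refine Set.Finite.of_finite_image (f := fun s => (s.corner, s.free))
    ((hf.prod (Set.finite_univ (α := Finset (Fin d)))).subset ?_) ?_
  · rintro _ ⟨s, hs, rfl⟩
    refine ⟨fun v => ?_, mem_univ _⟩
    have hmem : (fun v => (s.corner v : ℝ)) ∈ s.carrier := fun v =>
      ⟨fun _ => ⟨le_rfl, by linarith⟩, fun _ => rfl⟩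
    have := hs hmem
    rw [mem_closedBall_zero_iff, pi_norm_le_iff_of_nonneg (Nat.cast_nonneg N)] at this
    have h1 := this v
    rw [Real.norm_eq_abs, abs_le] at h1
    exact ⟨by exact_mod_cast h1.1, by exact_mod_cast h1.2⟩
  · intro s _ t _ h
    exact ext' (congrArg Prod.fst h) (congrArg Prod.snd h)

theorem dist_le_one {s : GridCell (Fin d)} {x y : Fin d → ℝ} (hx : x ∈ s.carrier)
    (hy : y ∈ s.carrier) : dist x y ≤ 1 := by
  rw [dist_pi_le_iff zero_le_one]
  intro v
  rw [Real.dist_eq, abs_le]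
  by_cases hv : v ∈ s.free
  · have h1 := (hx v).1 hv
    have h2 := (hy v).1 hv
    constructor <;> linarith
  · rw [(hx v).2 hv, (hy v).2 hv]
    constructor <;> linarith

end GridCell

/-- If `g` is close enough to `q` on the cube, then a shrunk copy of `g` and a small homotopy near
the boundary fit together to a map which agrees with `q` on the boundary. -/
theorem exists_collar {X : Type*} [PseudoMetricSpace X] (d : ℕ)
    (hX : ∀ k ≤ d, ControlledFilling k X) (ε : X → ℝ) (hε : LipPos ε) :
    ∃ δ : X → ℝ, LipPos δ ∧ ∀ q g : (Fin d → ℝ) → X, ContinuousOn q (Metric.closedBall 0 1) →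
      ContinuousOn g (Metric.closedBall 0 1) →
      (∀ z ∈ Metric.closedBall 0 1, dist (g z) (q z) < δ (q z)) →
      ∃ q' : (Fin d → ℝ) → X, ContinuousOn q' (Metric.closedBall 0 1) ∧
        EqOn q' q (Metric.sphere 0 1) ∧ ∀ z ∈ Metric.closedBall 0 1,
          (∃ w ∈ Metric.closedBall 0 1, q' z = g w) ∨
          ∃ w ∈ Metric.sphere 0 1, dist (q' z) (q w) < ε (q w) := by
  obtain ⟨δ, hδ, hδε, hext⟩ := GridCell.exists_extension (V := Fin d) (d + 1)
    (fun k hk => hX k (Nat.lt_succ_iff.1 hk)) ε hε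
  refine ⟨δ, hδ, fun q g hq hg hgq => ?_⟩
  -- Radial map: multiplication by 3 on the ball of radius 1/3, projection to the sphere outside.
  -- Thus `q ∘ w` is a shrunk copy of `q` surrounded by a collar with values in `q` of the sphere.
  let w : (Fin d → ℝ) → (Fin d → ℝ) := fun z => (max (1 / 3) ‖z‖)⁻¹ • z
  have hmax : ∀ z : Fin d → ℝ, (0 : ℝ) < max (1 / 3) ‖z‖ := fun z =>
    lt_max_of_lt_left (by norm_num)
  have hw : Continuous w := by
    refine Continuous.smul (Continuous.inv₀ (by fun_prop) fun z => (hmax z).ne') continuous_id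
  have hwball : ∀ z, w z ∈ Metric.closedBall (0 : Fin d → ℝ) 1 := fun z => by
    rw [mem_closedBall_zero_iff, norm_smul, norm_inv, Real.norm_of_nonneg (hmax z).le,
      inv_mul_le_one₀ (hmax z)]
    exact le_max_right _ _
  have hB : ContinuousOn (fun z => q (w z)) (Metric.closedBall 0 1) :=
    hq.comp hw.continuousOn fun z _ => hwball z
  have hcpt : IsCompact (Metric.closedBall (0 : Fin d → ℝ) 1) := isCompact_closedBall _ _
  obtain ⟨z₀, -, hz₀⟩ := hcpt.exists_isMinOn ⟨0, Metric.mem_closedBall_self zero_le_one⟩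
    (hδ.continuous.comp_continuousOn hB)
  obtain ⟨η, hη, hηB⟩ := Metric.uniformContinuousOn_iff.1
    (hcpt.uniformContinuousOn_of_continuous hB) (δ (q (w z₀))) (hδ.1 _)
  obtain ⟨n, hn⟩ := exists_nat_one_div_lt hη
  -- After enlarging the cube by the factor 3 * M, grid cells are so small that `q ∘ w` varies on
  -- them by less than the minimum of δ.
  let M : ℕ := n + 1
  have hM : (0 : ℝ) < M := by positivity
  have hMη : 1 / (M : ℝ) < η := by simpa [M] using hn
  have h3M : ((3 * M : ℕ) : ℝ) = 3 * M := by push_cast; ring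
  let G : Set (GridCell (Fin d)) := {c | c.carrier ⊆ Metric.closedBall 0 ((3 * M : ℕ) : ℝ)}
  -- The map is prescribed on the inner ball (a copy of `g`) and on the outer sphere (the values of
  -- `q`); the extension lemma fills the collar between them.
  let L : Set (GridCell (Fin d)) := {c | c.carrier ⊆ Metric.closedBall 0 (M : ℝ) ∨
    c.carrier ⊆ Metric.sphere 0 ((3 * M : ℕ) : ℝ)}
  let ρ : (Fin d → ℝ) → (Fin d → ℝ) := fun x => (3 * M : ℝ)⁻¹ • x
  have hρn : ∀ x, ‖ρ x‖ = (3 * M : ℝ)⁻¹ * ‖x‖ := fun x => by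
    rw [norm_smul, Real.norm_of_nonneg (by positivity)]
  let b : (Fin d → ℝ) → X := fun x => q (w (ρ x))
  classical
  let h : (Fin d → ℝ) → X := fun x =>
    if x ∈ Metric.closedBall (0 : Fin d → ℝ) (M : ℝ) then g ((M : ℝ)⁻¹ • x) else q (ρ x)
  have hin : ∀ x ∈ Metric.closedBall (0 : Fin d → ℝ) (M : ℝ),
      (M : ℝ)⁻¹ • x ∈ Metric.closedBall (0 : Fin d → ℝ) 1 ∧ w (ρ x) = (M : ℝ)⁻¹ • x := by
    intro x hx
    rw [mem_closedBall_zero_iff] at hx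
    constructor
    · rw [mem_closedBall_zero_iff, norm_smul, norm_inv, Real.norm_of_nonneg hM.le,
        inv_mul_le_one₀ hM]
      exact hx
    · have : ‖ρ x‖ ≤ 1 / 3 := by
        rw [hρn, inv_mul_le_iff₀ (by positivity)]
        linarith
      simp only [w, max_eq_left this, ρ, smul_smul]
      congr 1
      field_simp
  have hout : ∀ x ∈ Metric.sphere (0 : Fin d → ℝ) ((3 * M : ℕ) : ℝ),
      x ∉ Metric.closedBall (0 : Fin d → ℝ) (M : ℝ) ∧
      ρ x ∈ Metric.sphere (0 : Fin d → ℝ) 1 ∧ w (ρ x) = ρ x := by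
    intro x hx
    rw [mem_sphere_zero_iff_norm, h3M] at hx
    have h1 : ‖ρ x‖ = 1 := by
      rw [hρn, hx]; field_simp
    refine ⟨fun h => ?_, mem_sphere_zero_iff_norm.2 h1, ?_⟩
    · rw [mem_closedBall_zero_iff, hx] at h
      linarith
    · simp only [w, h1]
      norm_num
  have hρball : ∀ x ∈ Metric.closedBall (0 : Fin d → ℝ) ((3 * M : ℕ) : ℝ),
      ρ x ∈ Metric.closedBall (0 : Fin d → ℝ) 1 := fun x hx => by
    rw [mem_closedBall_zero_iff, h3M] at hx
    rw [mem_closedBall_zero_iff, hρn, inv_mul_le_one₀ (by positivity)]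
    exact hx
  obtain ⟨H, hHL, hHc, hHd⟩ := hext G L b h (fun t ht s hs => hs.trans ht)
    (fun t ht s hs => ht.imp hs.trans hs.trans)
    (by
      rintro c (hc | hc)
      · have : ContinuousOn (fun x => g ((M : ℝ)⁻¹ • x)) c.carrier :=
          hg.comp (by fun_prop) fun x hx => (hin x (hc hx)).1
        exact this.congr fun x hx => if_pos (hc hx)
      · have : ContinuousOn (fun x => q (ρ x)) c.carrier :=
          hq.comp (by fun_prop) fun x hx =>
            Metric.sphere_subset_closedBall (hout x (hc hx)).2.1
        exact this.congr fun x hx => if_neg (hout x (hc hx)).1)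
    (by
      rintro c (hc | hc) x hx
      · have h1 := hin x (hc hx)
        simp only [h, if_pos (hc hx), b, h1.2]
        exact hgq _ h1.1
      · have h1 := hout x (hc hx)
        simp only [h, if_neg h1.1, b, h1.2.2, dist_self]
        exact hδ.1 _)
    (by
      intro c hc x hx y hy
      have h1 : dist (ρ x) (ρ y) < η := by
        simp only [ρ]
        rw [dist_smul₀, Real.norm_of_nonneg (by positivity)]
        have h2 := GridCell.dist_le_one hx hy
        calc (3 * M : ℝ)⁻¹ * dist x y ≤ (3 * M : ℝ)⁻¹ * 1 := by gcongr
          _ ≤ 1 / (M : ℝ) := by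
            rw [mul_one, one_div]
            gcongr
            linarith
          _ < η := hMη
      exact (hηB _ (hρball x (hc hx)) _ (hρball y (hc hy)) h1).trans_le
        (hz₀ (hρball x (hc hx))))
  have hcell : ∀ x : Fin d → ℝ, ∃ s : GridCell (Fin d), x ∈ s.inner := fun x =>
    GridCell.exists_inner (t := ⟨fun v => ⌊x v⌋, Finset.univ⟩) fun v =>
      ⟨fun _ => ⟨Int.floor_le _, (Int.lt_floor_add_one _).le⟩, fun h => (h (Finset.mem_univ v)).elim⟩
  have hdim : ∀ s : GridCell (Fin d), s.dim < d + 1 := fun s => by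
    have := Finset.card_le_univ s.free
    rw [Fintype.card_fin] at this
    exact Nat.lt_succ_iff.2 this
  have hHcont : ContinuousOn H (Metric.closedBall 0 ((3 * M : ℕ) : ℝ)) := by
    have hfin : Finite G := (GridCell.finite_carrier_subset_closedBall (3 * M)).to_subtype
    have : ContinuousOn H (⋃ s : G, s.1.carrier) :=
      (locallyFinite_of_finite _).continuousOn_iUnion (fun s => s.1.isClosed_carrier)
        fun s => hHc s.1 s.2 (hdim _)
    refine this.mono fun x hx => ?_
    obtain ⟨s, hs⟩ := hcell x
    exact mem_iUnion.2 ⟨⟨s, GridCell.carrier_subset_closedBall hs hx⟩,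
      s.inner_subset_carrier hs⟩
  have hσ : ∀ z : Fin d → ℝ, ρ ((3 * M : ℝ) • z) = z := fun z => by
    simp only [ρ, smul_smul]
    rw [inv_mul_cancel₀ (by positivity), one_smul]
  have hσn : ∀ z : Fin d → ℝ, ‖(3 * M : ℝ) • z‖ = (3 * M : ℝ) * ‖z‖ := fun z => by
    rw [norm_smul, Real.norm_of_nonneg (by positivity)]
  have hσball : ∀ z ∈ Metric.closedBall (0 : Fin d → ℝ) 1,
      (3 * M : ℝ) • z ∈ Metric.closedBall (0 : Fin d → ℝ) ((3 * M : ℕ) : ℝ) := fun z hz => by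
    rw [mem_closedBall_zero_iff] at hz ⊢
    rw [hσn, h3M]
    exact mul_le_of_le_one_right (by positivity) hz
  refine ⟨fun z => H ((3 * M : ℝ) • z), hHcont.comp (by fun_prop) hσball, fun z hz => ?_,
    fun z hz => ?_⟩
  · have hx : (3 * M : ℝ) • z ∈ Metric.sphere (0 : Fin d → ℝ) ((3 * M : ℕ) : ℝ) := by
      rw [mem_sphere_zero_iff_norm] at hz ⊢
      rw [hσn, hz, h3M, mul_one]
    obtain ⟨s, hs⟩ := hcell ((3 * M : ℝ) • z)
    have hsL : s ∈ L := Or.inr (GridCell.carrier_subset_sphere (by positivity) hs hx)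
    simp only
    rw [hHL s hsL (s.inner_subset_carrier hs)]
    simp only [h, if_neg (hout _ hx).1, hσ]
  · obtain ⟨s, hs⟩ := hcell ((3 * M : ℝ) • z)
    by_cases hx : (3 * M : ℝ) • z ∈ Metric.closedBall (0 : Fin d → ℝ) (M : ℝ)
    · refine Or.inl ⟨_, (hin _ hx).1, ?_⟩
      have hsL : s ∈ L := Or.inl (GridCell.carrier_subset_closedBall hs hx)
      simp only
      rw [hHL s hsL (s.inner_subset_carrier hs)]
      simp only [h, if_pos hx]
    · refine Or.inr ⟨w z, ?_, ?_⟩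
      · have h1 : 1 / 3 < ‖z‖ := by
          rw [mem_closedBall_zero_iff, hσn, not_le] at hx
          by_contra hle
          rw [not_lt] at hle
          have : 3 * (M : ℝ) * ‖z‖ ≤ 3 * M * (1 / 3) := by gcongr
          linarith
        rw [mem_sphere_zero_iff_norm, norm_smul, norm_inv, Real.norm_of_nonneg (hmax z).le,
          max_eq_right h1.le, inv_mul_cancel₀ (by linarith)]
      · have := hHd s (GridCell.carrier_subset_closedBall hs (hσball z hz)) (hdim s) _
          (s.inner_subset_carrier hs)
        simpa only [b, hσ] using this

/-! ### General position from the discrete discs property. -/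

section Approximation

variable {X : Type*} [MetricSpace X] {m : ℕ}

/-- Countably many maps of `d`-cubes, `d ≤ m`, can be approximated by maps whose images are pairwise
disjoint, locally finite and disjoint from the members of a locally finite family of compacta. -/
theorem DiscreteDiscsProperty.exists_approx (hdisc : DiscreteDiscsProperty m X) {d : ℕ}
    (hd : d ≤ m) {ι κ : Type*} [Countable ι] (f : ι → (Fin d → ℝ) → X)
    (hf : ∀ i, ContinuousOn (f i) (Metric.closedBall 0 1)) (C : κ → Set X)
    (hC : LocallyFinite C) (hCc : ∀ k, IsCompact (C k)) (δ : X → ℝ) (hδ : LipPos δ) :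
    ∃ g : ι → (Fin d → ℝ) → X, (∀ i, ContinuousOn (g i) (Metric.closedBall 0 1)) ∧
      (∀ i, ∀ z ∈ Metric.closedBall 0 1, dist (g i z) (f i z) < δ (f i z)) ∧
      LocallyFinite (fun i => g i '' Metric.closedBall 0 1) ∧
      (∀ i j, i ≠ j → Disjoint (g i '' Metric.closedBall 0 1) (g j '' Metric.closedBall 0 1)) ∧
      ∀ i k, Disjoint (g i '' Metric.closedBall 0 1) (C k) := by
  rcases isEmpty_or_nonempty ι with hι | hι
  · exact ⟨f, hf, fun i => (hι.false i).elim, locallyFinite_of_finite _,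
      fun i => (hι.false i).elim, fun i => (hι.false i).elim⟩
  obtain ⟨ε, hε, hεC, -⟩ := hC.exists_thick fun k => (hCc k).isClosed
  have hη := hδ.min (hε.mul_const (c := 1 / 4) (by norm_num) (by norm_num))
  set η : X → ℝ := fun x => min (δ x) (1 / 4 * ε x) with hηdef
  have hθ := hη.mul_const (c := 1 / 4) (by norm_num) (by norm_num)
  -- Each map is repeated infinitely often. Locally finitely many copies reach a given compact set,
  -- so some copy avoids the sets `C k`.
  obtain ⟨e⟩ : Nonempty (ℕ ≃ ι × ℕ) := nonempty_equiv_of_countable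
  have hball : ∀ z : Fin d → ℝ, z ∈ Metric.closedBall (0 : Fin d → ℝ) 1 ↔
      ∀ i, -1 ≤ z i ∧ z i ≤ 1 := fun z => by
    rw [mem_closedBall_zero_iff, pi_norm_le_iff_of_nonneg zero_le_one]
    simp only [Real.norm_eq_abs, abs_le]
  -- A `d`-cube is a coordinate projection of the `m`-cube; `σ` is a section of this projection.
  let r : (Fin m → unitInterval) → (Fin d → ℝ) := fun t i => 2 * (t (Fin.castLE hd i) : ℝ) - 1
  have hr : Continuous r := by
    refine continuous_pi fun i => ?_
    exact ((continuous_subtype_val.comp (continuous_apply _)).const_mul 2).sub continuous_const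
  have hrball : ∀ t, r t ∈ Metric.closedBall (0 : Fin d → ℝ) 1 := fun t => by
    rw [hball]
    intro i
    have h0 := (t (Fin.castLE hd i)).2.1
    have h1 := (t (Fin.castLE hd i)).2.2
    simp only [r]
    constructor <;> linarith
  let σ : (Fin d → ℝ) → (Fin m → unitInterval) := fun z j =>
    if h : (j : ℕ) < d then projIcc 0 1 zero_le_one ((z ⟨j, h⟩ + 1) / 2) else 0
  have hσ : Continuous σ := by
    refine continuous_pi fun j => ?_
    by_cases h : (j : ℕ) < d
    · simp only [σ, dif_pos h]
      exact continuous_projIcc.comp (by fun_prop)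
    · simp only [σ, dif_neg h]
      exact continuous_const
  have hrσ : ∀ z ∈ Metric.closedBall (0 : Fin d → ℝ) 1, r (σ z) = z := fun z hz => by
    rw [hball] at hz
    ext i
    have hi := hz i
    simp only [r, σ, Fin.val_castLE, Fin.is_lt, dif_pos, Fin.eta]
    rw [projIcc_of_mem zero_le_one (x := (z i + 1) / 2) ⟨by linarith, by linarith⟩]
    ring
  obtain ⟨G, hGlf, hGclose, hGdis⟩ := hdisc
    (fun n => ⟨fun t => f (e n).1 (r t), (hf _).comp_continuous hr hrball⟩)
    _ (isOpenCovering_ball hθ.1)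
  have hGLF : LocallyFinite fun n => range (G n) := by
    intro x
    obtain ⟨U, hU, hev⟩ := hGlf x
    obtain ⟨N, hN⟩ := eventually_atTop.1 hev
    refine ⟨U, hU, (finite_lt_nat N).subset fun n hn => ?_⟩
    by_contra hlt
    exact hn.ne_empty (hN n (not_lt.1 hlt))
  have hclose : ∀ i n, ∀ z ∈ Metric.closedBall (0 : Fin d → ℝ) 1,
      dist (G (e.symm (i, n)) (σ z)) (f i z) < η (f i z) := by
    intro i n z hz
    obtain ⟨_, ⟨x, rfl⟩, h1, h2⟩ := hGclose (e.symm (i, n)) (σ z)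
    simp only [ContinuousMap.coe_mk, Equiv.apply_symm_apply, hrσ z hz, Metric.mem_ball] at h1 h2
    have h3 := hη.2 x (f i z)
    rw [dist_comm] at h3
    have h4 := dist_triangle_right (G (e.symm (i, n)) (σ z)) (f i z) x
    linarith [hη.1 x]
  have hsel : ∀ i, ∃ n, ∀ k, Disjoint (range fun z : Metric.closedBall (0 : Fin d → ℝ) 1 =>
      G (e.symm (i, n)) (σ z)) (C k) := by
    intro i
    have hcpt : IsCompact (f i '' Metric.closedBall 0 1) :=
      (isCompact_closedBall _ _).image_of_continuousOn (hf i)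
    have hT := hεC.finite_nonempty_inter_compact hcpt
    -- The approximations can only reach those `C k` whose thickening meets the compact image of `f
    -- i`; these are finitely many.
    have hK : IsCompact (⋃ k ∈ {k | (thick ε (C k) ∩ f i '' Metric.closedBall 0 1).Nonempty}, C k) :=
      hT.isCompact_biUnion fun k _ => hCc k
    have hfin := hGLF.finite_nonempty_inter_compact hK
    have hinj : Function.Injective fun n : ℕ => e.symm (i, n) := fun a b h => by
      simpa using h
    obtain ⟨n, hn⟩ := (hfin.preimage hinj.injOn).exists_notMem
    refine ⟨n, fun k => disjoint_left.2 ?_⟩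
    rintro _ ⟨⟨z, hz⟩, rfl⟩ hk
    refine hn ⟨_, mem_range_self _, mem_biUnion (x := k) ⟨f i z, ⟨_, hk, ?_⟩,
      mem_image_of_mem _ hz⟩ hk⟩
    have h1 := hclose i n z hz
    simp only at h1 ⊢
    set y := G (e.symm (i, n)) (σ z)
    have h2 : η (f i z) ≤ 1 / 4 * ε (f i z) := min_le_right _ _
    have h3 := hε.2 (f i z) y
    have h4 := hε.1 y
    rw [dist_comm] at h1
    linarith
  choose n hn using hsel
  have hsub : ∀ i, (fun z => G (e.symm (i, n i)) (σ z)) '' Metric.closedBall 0 1 ⊆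
      range (G (e.symm (i, n i))) := by
    rintro i _ ⟨z, -, rfl⟩
    exact mem_range_self _
  have hinj : Function.Injective fun i => e.symm (i, n i) := fun a b h => by
    have := e.symm.injective h
    exact congrArg Prod.fst this
  refine ⟨fun i z => G (e.symm (i, n i)) (σ z),
    fun i => ((G _).continuous.comp hσ).continuousOn,
    fun i z hz => (hclose i _ z hz).trans_le (min_le_left _ _),
    (hGLF.comp_injective hinj).subset hsub, fun i j hij => ?_, fun i k => ?_⟩
  · exact (hGdis (hinj.ne hij)).mono (hsub i) (hsub j)
  · refine (hn i k).mono_left ?_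
    rintro _ ⟨z, hz, rfl⟩
    exact ⟨⟨z, hz⟩, rfl⟩

/-- Perturbing the `d`-cells of a complex, relative to their boundaries. -/
theorem GridCell.exists_perturbation (hdisc : DiscreteDiscsProperty m X) {d : ℕ} (hd : d ≤ m)
    (hX : ∀ k ≤ d, ControlledFilling k X) {V : Type*} {K : Set (GridCell V)} (hK : K.Countable)
    {q : (V → ℝ) → X} (hq : ∀ c ∈ K, c.dim < d + 1 → ContinuousOn q c.carrier)
    (hlf : LocallyFinite fun c : {c // c ∈ K ∧ c.dim < d} => q '' c.1.carrier)
    (ε : X → ℝ) (hε : LipPos ε) :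
    ∃ (q' : (V → ℝ) → X) (g : GridCell V → Set X),
      (∀ c ∈ K, c.dim < d + 1 → ContinuousOn q' c.carrier) ∧
      (∀ c ∈ K, c.dim < d → EqOn q' q c.carrier) ∧
      (∀ c ∈ K, c.dim = d → q' '' c.carrier ⊆ g c ∪ thick ε (q '' c.bdry)) ∧
      (∀ c ∈ K, c.dim = d → g c ⊆ thick ε (q '' c.carrier)) ∧
      (LocallyFinite fun c : {c // c ∈ K ∧ c.dim = d} => g c.1) ∧
      (∀ c ∈ K, c.dim = d → ∀ c' ∈ K, c'.dim = d → c ≠ c' → Disjoint (g c) (g c')) ∧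
      ∀ c ∈ K, c.dim = d → ∀ c' ∈ K, c'.dim < d → Disjoint (g c) (q '' c'.carrier) := by
  obtain ⟨δ, hδ, hcollar⟩ := exists_collar d hX ε hε
  choose! κ π hκ hπ h1 h2 h3 using fun (c : GridCell V) (hc : c.dim = d) => c.exists_coordinates hc
  have hball : ∀ c, c.dim = d → c.carrier = π c '' Metric.closedBall 0 1 := fun c hc => by
    ext x
    constructor
    · exact fun hx => ⟨κ c x, (h1 c hc x hx).1, (h1 c hc x hx).2⟩
    · rintro ⟨z, hz, rfl⟩
      exact (h2 c hc z hz).1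
  have hsph : ∀ c, c.dim = d → MapsTo (π c) (Metric.sphere 0 1) c.bdry := fun c hc z hz => by
    have hz' := h2 c hc z (Metric.sphere_subset_closedBall hz)
    rw [← h3 c hc _ hz'.1, hz'.2]
    exact hz
  have : Countable {c // c ∈ K ∧ c.dim = d} := (hK.mono fun c hc => hc.1).to_subtype
  have hqπ : ∀ c ∈ K, c.dim = d → ContinuousOn (q ∘ π c) (Metric.closedBall 0 1) := fun c hc hcd =>
    (hq c hc (by omega)).comp (hπ c hcd).continuousOn fun z hz => (h2 c hcd z hz).1
  -- The `G c` are the cores of the new cells. The bound by δ allows collars to be attached, the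
  -- bound by ε keeps the cores near the old cells.
  obtain ⟨G, hG, hGd, hGlf, hGdis, hGq⟩ := hdisc.exists_approx hd
    (fun c : {c // c ∈ K ∧ c.dim = d} => q ∘ π c.1)
    (fun c => hqπ c.1 c.2.1 c.2.2) _ hlf
    (fun c => c.1.isCompact_carrier.image_of_continuousOn (hq c.1 c.2.1 (by have := c.2.2; omega)))
    _ (hδ.min hε)
  have hex : ∀ c : {c // c ∈ K ∧ c.dim = d}, _ := fun c => hcollar (q ∘ π c.1) (G c)
    (hqπ c.1 c.2.1 c.2.2) (hG c) (fun z hz => (hGd c z hz).trans_le (min_le_left _ _))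
  choose Q hQ hQq hQc using hex
  classical
  let p : GridCell V → (V → ℝ) → X := fun c =>
    if h : c ∈ K ∧ c.dim = d then Q ⟨c, h⟩ ∘ κ c else q
  have hp : ∀ c (h : c ∈ K ∧ c.dim = d), p c = Q ⟨c, h⟩ ∘ κ c := fun c h => dif_pos h
  obtain ⟨q', hq', hq'p⟩ := GridCell.exists_glue {c | c ∈ K ∧ c.dim = d} d (fun c hc => hc.2) q p (by
    intro c hc x hx
    have hcd : c.dim = d := hc.2
    rw [hp c hc]
    have := hQq ⟨c, hc⟩ ((h3 c hcd x hx.1).2 hx)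
    simp only [Function.comp_apply] at this ⊢
    rw [this, (h1 c hcd x hx.1).2])
  have hold : ∀ c ∈ K, c.dim < d → EqOn q' q c.carrier := by
    intro c _ hcd x hx
    refine hq' x fun s hs hxs => ?_
    have := GridCell.dim_le_of_inner hxs hx
    rw [hs.2] at this
    omega
  let g : GridCell V → Set X := fun c =>
    if h : c ∈ K ∧ c.dim = d then G ⟨c, h⟩ '' Metric.closedBall 0 1 else ∅
  have hg : ∀ c (h : c ∈ K ∧ c.dim = d), g c = G ⟨c, h⟩ '' Metric.closedBall 0 1 :=
    fun c h => dif_pos h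
  refine ⟨q', g, fun c hc hcd => ?_, hold, fun c hc hcd => ?_, fun c hc hcd => ?_, ?_,
    fun c hc hcd c' hc' hcd' hne => ?_, fun c hc hcd c' hc' hcd' => ?_⟩
  · rcases Nat.lt_succ_iff_lt_or_eq.1 hcd with h | h
    · exact (hq c hc hcd).congr (hold c hc h)
    · refine ContinuousOn.congr ?_ (hq'p c ⟨hc, h⟩)
      rw [hp c ⟨hc, h⟩]
      exact (hQ _).comp (hκ c h).continuousOn fun x hx => (h1 c h x hx).1
  · rintro _ ⟨x, hx, rfl⟩
    rw [hq'p c ⟨hc, hcd⟩ hx, hp c ⟨hc, hcd⟩, hg c ⟨hc, hcd⟩]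
    rcases hQc ⟨c, hc, hcd⟩ (κ c x) (h1 c hcd x hx).1 with ⟨w, hw, h⟩ | ⟨w, hw, h⟩
    · exact Or.inl ⟨w, hw, h.symm⟩
    · exact Or.inr ⟨_, mem_image_of_mem q (hsph c hcd hw), h⟩
  · rw [hg c ⟨hc, hcd⟩]
    rintro _ ⟨z, hz, rfl⟩
    exact ⟨_, mem_image_of_mem q (h2 c hcd z hz).1,
      (hGd ⟨c, hc, hcd⟩ z hz).trans_le (min_le_right _ _)⟩
  · have : (fun c : {c // c ∈ K ∧ c.dim = d} => g c.1) = fun c => G c '' Metric.closedBall 0 1 :=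
      funext fun c => hg c.1 c.2
    rw [this]
    exact hGlf
  · rw [hg c ⟨hc, hcd⟩, hg c' ⟨hc', hcd'⟩]
    exact hGdis _ _ fun h => hne (congrArg Subtype.val h)
  · rw [hg c ⟨hc, hcd⟩]
    exact hGq ⟨c, hc, hcd⟩ ⟨c', hc', hcd'⟩

end Approximation

/-! ### Realizing cubical complexes in X, skeleton by skeleton. -/

/-- `q` is continuous on the cells of `K` of dimension `< d`, maps them to a locally finite family
and maps disjoint cells to disjoint sets. -/
structure IsGoodBelow {V X : Type*} [TopologicalSpace X] (K : Set (GridCell V)) (d : ℕ)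
    (q : (V → ℝ) → X) : Prop where
  continuousOn : ∀ c ∈ K, c.dim < d → ContinuousOn q c.carrier
  locallyFinite : LocallyFinite fun c : {c // c ∈ K ∧ c.dim < d} => q '' c.1.carrier
  disjoint : ∀ c ∈ K, c.dim < d → ∀ c' ∈ K, c'.dim < d → Disjoint c.carrier c'.carrier →
    Disjoint (q '' c.carrier) (q '' c'.carrier)

theorem IsGoodBelow.congr {V X : Type*} [TopologicalSpace X] {K : Set (GridCell V)} {d : ℕ}
    {q q' : (V → ℝ) → X} (h : IsGoodBelow K d q)
    (hqq' : ∀ c ∈ K, c.dim < d → EqOn q' q c.carrier) : IsGoodBelow K d q' := by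
  refine ⟨fun c hc hcd => (h.continuousOn c hc hcd).congr (hqq' c hc hcd), ?_,
    fun c hc hcd c' hc' hcd' => ?_⟩
  · have : (fun c : {c // c ∈ K ∧ c.dim < d} => q' '' c.1.carrier) =
        fun c : {c // c ∈ K ∧ c.dim < d} => q '' c.1.carrier :=
      funext fun c => (hqq' c.1 c.2.1 c.2.2).image_eq
    rw [this]
    exact h.locallyFinite
  · rw [(hqq' c hc hcd).image_eq, (hqq' c' hc' hcd').image_eq]
    exact h.disjoint c hc hcd c' hc' hcd'

namespace GridCell

variable {X : Type*} [MetricSpace X] {m : ℕ} {V : Type*} {K : Set (GridCell V)}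

/-- A boundary point lies in a proper face, so whatever is close to the image of the boundary, in
particular a collar, is governed by a cell of smaller dimension. -/
theorem mem_thick_bdry {c : GridCell V} (hKf : ∀ s : GridCell V, s.carrier ⊆ c.carrier → s ∈ K)
    {ε : X → ℝ} {q : (V → ℝ) → X} {y : X} (h : y ∈ thick ε (q '' c.bdry)) :
    ∃ s ∈ K, s.carrier ⊆ c.carrier ∧ s.dim < c.dim ∧ y ∈ thick ε (q '' s.carrier) := by
  obtain ⟨_, ⟨x, hx, rfl⟩, hd⟩ := h
  obtain ⟨s, hxs, hs, hsd⟩ := exists_inner_of_bdry hx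
  exact ⟨s, hKf s hs, hs, hsd, q x, mem_image_of_mem q (s.inner_subset_carrier hxs), hd⟩

/-- Making the images of the `d`-cells locally finite, and disjoint from the images of the
lower-dimensional cells which they do not meet. -/
theorem exists_separate_lower (hdisc : DiscreteDiscsProperty m X) {d : ℕ} (hd : d ≤ m)
    (hX : ∀ k ≤ d, ControlledFilling k X) (hK : K.Countable)
    (hKf : ∀ t ∈ K, ∀ s : GridCell V, s.carrier ⊆ t.carrier → s ∈ K)
    (hKs : ∀ s ∈ K, {t | t ∈ K ∧ s.carrier ⊆ t.carrier}.Finite)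
    {q : (V → ℝ) → X} (hq : ∀ c ∈ K, c.dim < d + 1 → ContinuousOn q c.carrier)
    (hgood : IsGoodBelow K d q) (ε : X → ℝ) (hε : LipPos ε) :
    ∃ q' : (V → ℝ) → X, (∀ c ∈ K, c.dim < d + 1 → ContinuousOn q' c.carrier) ∧
      (∀ c ∈ K, c.dim < d → EqOn q' q c.carrier) ∧
      (∀ c ∈ K, c.dim = d → q' '' c.carrier ⊆ thick ε (q '' c.carrier)) ∧
      (LocallyFinite fun c : {c // c ∈ K ∧ c.dim < d + 1} => q' '' c.1.carrier) ∧
      ∀ c ∈ K, c.dim = d → ∀ c' ∈ K, c'.dim < d → Disjoint c.carrier c'.carrier →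
        Disjoint (q' '' c.carrier) (q' '' c'.carrier) := by
  obtain ⟨ε₁, hε₁, hlf₁, hdis₁⟩ := hgood.locallyFinite.exists_thick fun c =>
    (c.1.isCompact_carrier.image_of_continuousOn (hgood.continuousOn c.1 c.2.1 c.2.2)).isClosed
  have hη := hε.min hε₁
  set η : X → ℝ := fun x => min (ε x) (ε₁ x) with hηdef
  have hηε : ∀ x, η x ≤ ε x := fun x => min_le_left _ _
  have hηε₁ : ∀ x, η x ≤ ε₁ x := fun x => min_le_right _ _
  obtain ⟨q', g, hq'c, hq'q, hq'g, hgt, hglf, -, hgq⟩ :=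
    exists_perturbation hdisc hd hX hK hq hgood.locallyFinite η hη
  refine ⟨q', hq'c, hq'q, fun c hc hcd => ?_, ?_, fun c hc hcd c' hc' hcd' hcc => ?_⟩
  · refine (hq'g c hc hcd).trans (union_subset ?_ ?_)
    · exact (hgt c hc hcd).trans (thick_mono hηε subset_rfl)
    · exact thick_mono hηε (image_mono c.bdry_subset_carrier)
  · intro x
    obtain ⟨W₁, hW₁, hf₁⟩ := hlf₁ x
    obtain ⟨W₂, hW₂, hf₂⟩ := hglf x
    refine ⟨W₁ ∩ W₂, inter_mem hW₁ hW₂, ?_⟩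
    refine Finite.of_finite_image (f := Subtype.val) ?_ Subtype.val_injective.injOn
    -- Lower cells and cores are locally finite families. A collar that comes close does so near a
    -- proper face, and each face has finitely many cofaces.
    refine (((hf₁.image Subtype.val).union (hf₂.image Subtype.val)).union
      (hf₁.biUnion fun s _ => hKs s.1 s.2.1)).subset ?_
    rintro _ ⟨⟨c, hc, hcd⟩, ⟨y, hy, hyW⟩, rfl⟩
    rcases Nat.lt_succ_iff_lt_or_eq.1 hcd with h | h
    · refine Or.inl (Or.inl ⟨⟨c, hc, h⟩, ⟨y, ?_, hyW.1⟩, rfl⟩)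
      refine subset_thick hε₁.1 _ ?_
      rwa [← (hq'q c hc h).image_eq]
    · rcases hq'g c hc h hy with hyg | hyt
      · exact Or.inl (Or.inr ⟨⟨c, hc, h⟩, ⟨y, hyg, hyW.2⟩, rfl⟩)
      · obtain ⟨s, hs, hsc, hsd, hys⟩ := mem_thick_bdry (hKf c hc) hyt
        refine Or.inr (mem_biUnion (x := ⟨s, hs, h ▸ hsd⟩) ?_ ⟨hc, hsc⟩)
        exact ⟨y, thick_mono hηε₁ subset_rfl hys, hyW.1⟩
  · rw [(hq'q c' hc' hcd').image_eq]
    refine disjoint_left.2 fun y hy hy' => ?_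
    rcases hq'g c hc hcd hy with hyg | hyt
    · exact (hgq c hc hcd c' hc' hcd').notMem_of_mem_left hyg hy'
    · obtain ⟨s, hs, hsc, hsd, hys⟩ := mem_thick_bdry (hKf c hc) hyt
      have hsd : s.dim < d := hcd ▸ hsd
      exact (hdis₁ ⟨s, hs, hsd⟩ ⟨c', hc', hcd'⟩
        (hgood.disjoint s hs hsd c' hc' hcd' (hcc.mono_left hsc))).notMem_of_mem_left
          (thick_mono hηε₁ subset_rfl hys) (subset_thick hε₁.1 _ hy')

/-- After one perturbation a collar of one `d`-cell may still hit the core of another. But then the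
`d`-cells already miss the lower cells they should miss, and a thickening separates these pairs. A
second perturbation within it keeps collars, which are near proper faces, away from the other
`d`-cells, while the new cores are pairwise disjoint. -/
theorem exists_isGoodBelow_succ (hdisc : DiscreteDiscsProperty m X) {d : ℕ} (hd : d ≤ m)
    (hX : ∀ k ≤ d, ControlledFilling k X) (hK : K.Countable)
    (hKf : ∀ t ∈ K, ∀ s : GridCell V, s.carrier ⊆ t.carrier → s ∈ K)
    (hKs : ∀ s ∈ K, {t | t ∈ K ∧ s.carrier ⊆ t.carrier}.Finite)
    {q : (V → ℝ) → X} (hq : ∀ c ∈ K, c.dim < d + 1 → ContinuousOn q c.carrier)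
    (hgood : IsGoodBelow K d q) (ε : X → ℝ) (hε : LipPos ε) :
    ∃ q' : (V → ℝ) → X, IsGoodBelow K (d + 1) q' ∧
      (∀ c ∈ K, c.dim < d → EqOn q' q c.carrier) ∧
      ∀ c ∈ K, c.dim = d → q' '' c.carrier ⊆ thick ε (q '' c.carrier) := by
  have hε4 := hε.mul_const (c := 1 / 4) (by norm_num) (by norm_num)
  obtain ⟨q₁, hq₁c, hq₁q, hq₁t, hq₁lf, hq₁dis⟩ :=
    exists_separate_lower hdisc hd hX hK hKf hKs hq hgood _ hε4
  obtain ⟨ε₂, hε₂, hlf₂, hdis₂⟩ := hq₁lf.exists_thick fun c =>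
    (c.1.isCompact_carrier.image_of_continuousOn (hq₁c c.1 c.2.1 c.2.2)).isClosed
  have hη := hε4.min hε₂
  set η : X → ℝ := fun x => min (1 / 4 * ε x) (ε₂ x) with hηdef
  have hηε : ∀ x, η x ≤ 1 / 4 * ε x := fun x => min_le_left _ _
  have hηε₂ : ∀ x, η x ≤ ε₂ x := fun x => min_le_right _ _
  have hgood₁ : IsGoodBelow K d q₁ := hgood.congr hq₁q
  obtain ⟨q', g, hq'c, hq'q, hq'g, hgt, -, hgdis, -⟩ :=
    exists_perturbation hdisc hd hX hK hq₁c hgood₁.locallyFinite η hη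
  have hlow : ∀ c ∈ K, c.dim < d + 1 → ∀ c' ∈ K, c'.dim < d → Disjoint c.carrier c'.carrier →
      Disjoint (thick ε₂ (q₁ '' c.carrier)) (thick ε₂ (q₁ '' c'.carrier)) := by
    intro c hc hcd c' hc' hcd' hcc
    refine hdis₂ ⟨c, hc, hcd⟩ ⟨c', hc', by omega⟩ ?_
    rcases Nat.lt_succ_iff_lt_or_eq.1 hcd with h | h
    · exact hgood₁.disjoint c hc h c' hc' hcd' hcc
    · exact hq₁dis c hc h c' hc' hcd' hcc
  have hthη : ∀ c ∈ K, c.dim < d + 1 → q' '' c.carrier ⊆ thick η (q₁ '' c.carrier) := by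
    intro c hc hcd
    rcases Nat.lt_succ_iff_lt_or_eq.1 hcd with h | h
    · rw [(hq'q c hc h).image_eq]
      exact subset_thick hη.1 _
    · exact (hq'g c hc h).trans (union_subset (hgt c hc h)
        (thick_mono (fun _ => le_rfl) (image_mono c.bdry_subset_carrier)))
  have hth : ∀ c ∈ K, c.dim < d + 1 → q' '' c.carrier ⊆ thick ε₂ (q₁ '' c.carrier) :=
    fun c hc hcd => (hthη c hc hcd).trans (thick_mono hηε₂ subset_rfl)
  refine ⟨q', ⟨hq'c, hlf₂.subset fun c => hth c.1 c.2.1 c.2.2, ?_⟩,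
    fun c hc hcd => (hq'q c hc hcd).trans (hq₁q c hc hcd), fun c hc hcd => ?_⟩
  · intro c hc hcd c' hc' hcd' hcc
    rcases Nat.lt_succ_iff_lt_or_eq.1 hcd with h | h
    · exact ((hlow c' hc' hcd' c hc h hcc.symm).mono (hth c' hc' hcd') (hth c hc hcd)).symm
    rcases Nat.lt_succ_iff_lt_or_eq.1 hcd' with h' | h'
    · exact (hlow c hc hcd c' hc' h' hcc).mono (hth c hc hcd) (hth c' hc' hcd')
    have hne : c ≠ c' := by
      rintro rfl
      obtain ⟨x, hx⟩ := c.inner_nonempty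
      exact hcc.notMem_of_mem_left (c.inner_subset_carrier hx) (c.inner_subset_carrier hx)
    have haux : ∀ c ∈ K, c.dim = d → ∀ c' ∈ K, c'.dim = d → Disjoint c.carrier c'.carrier →
        ∀ y ∈ q' '' c.carrier, y ∉ thick η (q₁ '' c'.bdry) := by
      intro c hc h c' hc' h' hcc y hy hyt
      obtain ⟨s, hs, hsc, hsd, hys⟩ := mem_thick_bdry (hKf c' hc') hyt
      exact (hlow c hc (by omega) s hs (h' ▸ hsd) (hcc.mono_right hsc)).notMem_of_mem_left
        (hth c hc (by omega) hy) (thick_mono hηε₂ subset_rfl hys)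
    refine disjoint_left.2 fun y hy hy' => ?_
    refine (hgdis c hc h c' hc' h' hne).notMem_of_mem_left
      ((hq'g c hc h hy).resolve_right (haux c' hc' h' c hc h hcc.symm y hy'))
      ((hq'g c' hc' h' hy').resolve_right (haux c hc h c' hc' h' hcc y hy))
  · intro z hz
    obtain ⟨y, hy, hzy⟩ := hthη c hc (by omega) hz
    obtain ⟨x, hx, hyx⟩ := hq₁t c hc hcd hy
    refine ⟨x, hx, ?_⟩
    simp only at hyx
    have h1 := hηε y
    have h2 := hε.2 y x
    have h3 := dist_triangle z y x
    have h4 := hε.1 x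
    linarith

/-- Realization of cubical complexes: if the base points `β v` are close to one another on each
cell, there is a good map of the cells of dimension `< d` which is close to the base points. -/
theorem exists_realization [Nonempty X] (hdisc : DiscreteDiscsProperty m X)
    (hX : ∀ k ≤ m, ControlledFilling k X) (d : ℕ) (hd : d ≤ m + 1) (ε : X → ℝ) (hε : LipPos ε) :
    ∃ δ : X → ℝ, LipPos δ ∧ (∀ x, δ x ≤ ε x) ∧
      ∀ (K : Set (GridCell V)) (supp : GridCell V → Set V) (β : V → X), K.Countable →
      (∀ t ∈ K, ∀ s : GridCell V, s.carrier ⊆ t.carrier → s ∈ K) →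
      (∀ s ∈ K, {t | t ∈ K ∧ s.carrier ⊆ t.carrier}.Finite) →
      (∀ c ∈ K, (supp c).Nonempty) →
      (∀ t ∈ K, ∀ s : GridCell V, s.carrier ⊆ t.carrier → supp s ⊆ supp t) →
      (∀ c ∈ K, ∀ v ∈ supp c, ∀ w ∈ supp c, dist (β v) (β w) < δ (β v)) →
      ∃ q : (V → ℝ) → X, IsGoodBelow K d q ∧
        ∀ c ∈ K, c.dim < d → ∀ x ∈ c.carrier, ∀ v ∈ supp c, dist (q x) (β v) < ε (β v) := by
  induction d generalizing ε with
  | zero =>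
    obtain ⟨x₀⟩ := ‹Nonempty X›
    refine ⟨ε, hε, fun _ => le_rfl, fun K supp β _ _ _ _ _ _ => ⟨fun _ => x₀, ⟨by simp, ?_, by simp⟩,
      by simp⟩⟩
    intro x
    exact ⟨univ, univ_mem, (Set.finite_empty).subset fun c _ => (Nat.not_lt_zero _ c.2.2).elim⟩
  | succ d ih =>
    -- One eighth of ε each for the filling and for the perturbation; the rest absorbs the distances
    -- between base points and the variation of ε between them.
    have hε1 := hε.mul_const (c := 1 / 8) (by norm_num) (by norm_num)
    obtain ⟨δ₁, hδ₁, hδ₁ε, hfill⟩ := hX d (by omega) _ hε1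
    have hε2 := hδ₁.mul_const (c := 1 / 4) (by norm_num) (by norm_num)
    obtain ⟨δ, hδ, hδε, hrec⟩ := ih (by omega) _ hε2
    refine ⟨δ, hδ, fun x => ?_, fun K supp β hK hKf hKs hsupp hsuppf hβ => ?_⟩
    · linarith [hδε x, hδ₁ε x, hε.1 x, hδ₁.1 x]
    obtain ⟨q, hgood, hqβ⟩ := hrec K supp β hK hKf hKs hsupp hsuppf hβ
    have hex : ∀ c ∈ {c | c ∈ K ∧ c.dim = d}, ∃ p : (V → ℝ) → X, ContinuousOn p c.carrier ∧
        EqOn p q c.bdry ∧ ∃ v ∈ supp c, ∀ y ∈ c.carrier, dist (p y) (β v) < 1 / 8 * ε (β v) := by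
      rintro c ⟨hc, hcd⟩
      obtain ⟨v, hv⟩ := hsupp c hc
      obtain ⟨p, hp, hpq, hpB⟩ := CubeFills.gridCell (c := c) (q := q) (by
          rw [hcd]; exact hfill (β v))
        (continuousOn_bdry fun s hs hsd => hgood.continuousOn s (hKf c hc s hs) (hcd ▸ hsd))
        (by
          intro y hy
          obtain ⟨s, hys, hs, hsd⟩ := exists_inner_of_bdry hy
          obtain ⟨w, hw⟩ := hsupp s (hKf c hc s hs)
          have h1 := hqβ s (hKf c hc s hs) (hcd ▸ hsd) y (s.inner_subset_carrier hys) w hw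
          have h2 := hβ c hc v hv w (hsuppf c hc s hs hw)
          have h3 := hε2.2 (β w) (β v)
          rw [dist_comm] at h3
          have h4 := hδε (β v)
          have h5 := hδ₁.1 (β v)
          have h6 := dist_triangle_right (q y) (β v) (β w)
          rw [Metric.mem_ball]
          linarith)
      exact ⟨p, hp, hpq, v, hv, fun y hy => Metric.mem_ball.1 (hpB hy)⟩
    choose! p hp hpq v hv hpv using hex
    obtain ⟨q₁, hq₁, hq₁p⟩ := exists_glue {c | c ∈ K ∧ c.dim = d} d (fun c hc => hc.2) q p hpq
    have hold : ∀ c ∈ K, c.dim < d → EqOn q₁ q c.carrier := by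
      intro c _ hcd x hx
      refine hq₁ x fun s hs hxs => ?_
      have := dim_le_of_inner hxs hx
      rw [hs.2] at this
      omega
    have hq₁c : ∀ c ∈ K, c.dim < d + 1 → ContinuousOn q₁ c.carrier := by
      intro c hc hcd
      rcases Nat.lt_succ_iff_lt_or_eq.1 hcd with h | h
      · exact (hgood.continuousOn c hc h).congr (hold c hc h)
      · exact (hp c ⟨hc, h⟩).congr (hq₁p c ⟨hc, h⟩)
    obtain ⟨q₂, hgood₂, hq₂q, hq₂t⟩ := exists_isGoodBelow_succ hdisc (by omega)
      (fun k hk => hX k (by omega)) hK hKf hKs hq₁c (hgood.congr hold) _ hε1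
    refine ⟨q₂, hgood₂, fun c hc hcd x hx w hw => ?_⟩
    rcases Nat.lt_succ_iff_lt_or_eq.1 hcd with h | h
    · rw [hq₂q c hc h hx, hold c hc h hx]
      have := hqβ c hc h x hx w hw
      linarith [hδ₁ε (β w), hδ₁.1 (β w), hε.1 (β w)]
    · obtain ⟨_, ⟨x', hx', rfl⟩, hd1⟩ := hq₂t c hc h (mem_image_of_mem q₂ hx)
      rw [hq₁p c ⟨hc, h⟩ hx'] at hd1
      have hd2 := hpv c ⟨hc, h⟩ x' hx'
      have hd3 := hβ c hc w hw _ (hv c ⟨hc, h⟩)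
      have h1 := hε1.2 (p c x') (β (v c ⟨hc, h⟩))
      have h2 := hε1.2 (β (v c ⟨hc, h⟩)) (β w)
      have h3 := dist_triangle4 (q₂ x) (p c x') (β (v c ⟨hc, h⟩)) (β w)
      simp only at hd1 h1 h2
      rw [dist_comm (β w)] at hd3
      have h4 := hδε (β w)
      have h5 := hδ₁ε (β w)
      have h6 := hδ₁.1 (β w)
      have h7 := hε.1 (β w)
      linarith

end GridCell

/-! ### The cubical nerve of a star-finite cover. -/

section Nerve

variable {V Y : Type*}

/-- The cubical nerve of the family `O`: the cells of the cube `[0, 1]^V` on which some coordinate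
is equal to `1` and whose positive coordinates index members of `O` with a common point. -/
def cubicalNerve (O : V → Set Y) : Set (GridCell V) :=
  {c | (∀ x ∈ c.carrier, ∀ v, 0 ≤ x v ∧ x v ≤ 1) ∧ (∀ x ∈ c.carrier, ∃ v, x v = 1) ∧
    ∃ y, ∀ x ∈ c.carrier, ∀ v, 0 < x v → y ∈ O v}

/-- The coordinates which are positive somewhere on the cell. -/
def GridCell.supp (c : GridCell V) : Set V := {v | ∃ x ∈ c.carrier, 0 < x v}

theorem GridCell.corner_mem_carrier (c : GridCell V) :
    (fun v => (c.corner v : ℝ)) ∈ c.carrier := fun v =>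
  ⟨fun _ => ⟨le_rfl, by linarith⟩, fun _ => rfl⟩

theorem GridCell.supp_mono {s t : GridCell V} (h : s.carrier ⊆ t.carrier) : s.supp ⊆ t.supp :=
  fun _ ⟨x, hx, hv⟩ => ⟨x, h hx, hv⟩

namespace cubicalNerve

variable {O : V → Set Y} {c t : GridCell V}

theorem of_subset (ht : t ∈ cubicalNerve O) {s : GridCell V} (h : s.carrier ⊆ t.carrier) :
    s ∈ cubicalNerve O :=
  ⟨fun x hx => ht.1 x (h hx), fun x hx => ht.2.1 x (h hx),
    ht.2.2.imp fun _ hy x hx => hy x (h hx)⟩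

theorem supp_nonempty (hc : c ∈ cubicalNerve O) : c.supp.Nonempty := by
  obtain ⟨v, hv⟩ := hc.2.1 _ c.corner_mem_carrier
  exact ⟨v, _, c.corner_mem_carrier, by rw [hv]; exact one_pos⟩

theorem exists_mem (hc : c ∈ cubicalNerve O) : ∃ y, ∀ v ∈ c.supp, y ∈ O v := by
  obtain ⟨y, hy⟩ := hc.2.2
  exact ⟨y, fun v ⟨x, hx, hv⟩ => hy x hx v hv⟩

theorem free_of_inner (hc : c ∈ cubicalNerve O) {x : V → ℝ} (hx : x ∈ c.inner) {v : V}
    (hv : v ∈ c.free) : 0 < x v ∧ x v < 1 := by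
  have h1 := (hx v).1 hv
  have h2 := (hc.1 _ c.corner_mem_carrier v).1
  refine ⟨h2.trans_lt h1.1, lt_of_le_of_ne (hc.1 x (c.inner_subset_carrier hx) v).2 fun h => ?_⟩
  rw [h] at h1
  have h3 : c.corner v < 1 := by exact_mod_cast h1.1
  have h4 : (0 : ℤ) ≤ c.corner v := by exact_mod_cast h2
  have h5 : c.corner v = 0 := by omega
  rw [h5] at h1
  norm_num at h1

/-- At an interior point the free coordinates lie strictly between `0` and `1`, so a coordinate
equal to `1` is an additional positive one. All of them index members with a common point, whence
the strict inequality. -/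
theorem dim_lt {n : ℕ} (hO : ∀ (s : Finset V) (y : Y), (∀ i ∈ s, y ∈ O i) → s.card ≤ n)
    (hc : c ∈ cubicalNerve O) : c.dim < n := by
  classical
  obtain ⟨x, hx⟩ := c.inner_nonempty
  have hx' := c.inner_subset_carrier hx
  obtain ⟨w, hw⟩ := hc.2.1 x hx'
  obtain ⟨y, hy⟩ := hc.2.2
  have hwf : w ∉ c.free := fun h => (free_of_inner hc hx h).2.ne hw
  have := hO (insert w c.free) y fun v hv => by
    refine hy x hx' v ?_
    rcases Finset.mem_insert.1 hv with rfl | h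
    · rw [hw]; exact one_pos
    · exact (free_of_inner hc hx h).1
  rw [Finset.card_insert_of_notMem hwf] at this
  exact this

/-- A cell is determined by its free coordinates and by the corner coordinates equal to `1`. All of
these index members meeting `O w`, and there are finitely many. -/
theorem finite_mem_supp (hO : ∀ i, {j | (O i ∩ O j).Nonempty}.Finite) (w : V) :
    {t | t ∈ cubicalNerve O ∧ w ∈ t.supp}.Finite := by
  have h01 : ∀ t ∈ cubicalNerve O, ∀ v, t.corner v = 0 ∨ t.corner v = 1 := fun t ht v => by
    have h := ht.1 _ t.corner_mem_carrier v
    have h1 : (0 : ℤ) ≤ t.corner v := by exact_mod_cast h.1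
    have h2 : t.corner v ≤ 1 := by exact_mod_cast h.2
    omega
  refine Set.Finite.of_finite_image (f := fun t => ({v | t.corner v = 1}, (t.free : Set V)))
    (((hO w).finite_subsets.prod (hO w).finite_subsets).subset ?_) ?_
  · rintro _ ⟨t, ⟨ht, hw⟩, rfl⟩
    obtain ⟨y, hy⟩ := exists_mem ht
    refine ⟨fun v hv => ⟨y, hy w hw, hy v ?_⟩, fun v hv => ⟨y, hy w hw, hy v ?_⟩⟩
    · refine ⟨_, t.corner_mem_carrier, ?_⟩
      rw [show t.corner v = 1 from hv]
      norm_num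
    · obtain ⟨x, hx⟩ := t.inner_nonempty
      exact ⟨x, t.inner_subset_carrier hx, (free_of_inner ht hx hv).1⟩
  · rintro s ⟨hs, -⟩ t ⟨ht, -⟩ h
    have h1 : ∀ v, s.corner v = 1 ↔ t.corner v = 1 := fun v =>
      Set.ext_iff.1 (congrArg Prod.fst h) v
    refine GridCell.ext' (funext fun v => ?_) (Finset.coe_injective (congrArg Prod.snd h))
    have h2 := h1 v
    rcases h01 s hs v with h | h <;> rcases h01 t ht v with h' | h' <;> simp_all

theorem countable [Countable V] (hO : ∀ i, {j | (O i ∩ O j).Nonempty}.Finite) :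
    (cubicalNerve O).Countable := by
  refine (countable_iUnion fun w => (finite_mem_supp hO w).countable).mono fun t ht => ?_
  obtain ⟨w, hw⟩ := supp_nonempty ht
  exact mem_iUnion.2 ⟨w, ht, hw⟩

theorem finite_cofaces (hO : ∀ i, {j | (O i ∩ O j).Nonempty}.Finite) {s : GridCell V}
    (hs : s ∈ cubicalNerve O) : {t | t ∈ cubicalNerve O ∧ s.carrier ⊆ t.carrier}.Finite := by
  obtain ⟨w, hw⟩ := supp_nonempty hs
  exact (finite_mem_supp hO w).subset fun t ht => ⟨ht.1, GridCell.supp_mono ht.2 hw⟩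

/-- The point with coordinates `u` is in a cell of the nerve. -/
theorem exists_cell (hO : ∀ i, {j | (O i ∩ O j).Nonempty}.Finite) {u : V → ℝ} {y : Y}
    (h01 : ∀ v, 0 ≤ u v ∧ u v ≤ 1) (hpos : ∀ v, 0 < u v ↔ y ∈ O v) (hone : ∃ v, u v = 1) :
    ∃ c ∈ cubicalNerve O, u ∈ c.carrier ∧ ∀ v ∈ c.supp, y ∈ O v := by
  obtain ⟨w, hw⟩ := hone
  have hyw : y ∈ O w := (hpos w).1 (by rw [hw]; exact one_pos)
  have hfin : {v | y ∈ O v}.Finite := (hO w).subset fun v hv => ⟨y, hyw, hv⟩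
  -- Cells have finitely many free coordinates even when `V` is infinite; point-finiteness of the
  -- cover supplies such a cell, all other coordinates of `u` being `0`.
  obtain ⟨s, hs⟩ := GridCell.exists_inner (t := ⟨fun v => ⌊u v⌋, hfin.toFinset⟩) (x := u) (by
    intro v
    refine ⟨fun _ => ⟨Int.floor_le _, (Int.lt_floor_add_one _).le⟩, fun hv => ?_⟩
    have : u v = 0 := le_antisymm (not_lt.1 fun h => hv (hfin.mem_toFinset.2 ((hpos v).1 h)))
      (h01 v).1
    simp [this])
  have hfree : ∀ v ∈ s.free, s.corner v = 0 := fun v hv => by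
    have h1 := (hs v).1 hv
    have h2 := h01 v
    have h3 : (s.corner v : ℝ) < 1 := h1.1.trans_le h2.2
    have h4 : (0 : ℝ) < s.corner v + 1 := h2.1.trans_lt h1.2
    have h5 : s.corner v < 1 := by exact_mod_cast h3
    have h6 : 0 < s.corner v + 1 := by exact_mod_cast h4
    omega
  have hsupp : ∀ x ∈ s.carrier, ∀ v, 0 < x v → y ∈ O v := by
    intro x hx v hxv
    rw [← hpos]
    by_cases hv : v ∈ s.free
    · have h1 := ((hs v).1 hv).1
      rwa [hfree v hv, Int.cast_zero] at h1
    · rwa [(hs v).2 hv, ← (hx v).2 hv]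
  refine ⟨s, ⟨fun x hx v => ?_, fun x hx => ⟨w, ?_⟩, y, hsupp⟩, s.inner_subset_carrier hs,
    fun v ⟨x, hx, hv⟩ => hsupp x hx v hv⟩
  · by_cases hv : v ∈ s.free
    · have h1 := (hx v).1 hv
      rw [hfree v hv] at h1
      simpa using h1
    · rw [(hx v).2 hv, ← (hs v).2 hv]
      exact h01 v
  · have hwf : w ∉ s.free := fun h => by
      have h1 := (hs w).1 h
      rw [hfree w h, hw] at h1
      norm_num at h1
    rw [(hx w).2 hwf, ← (hs w).2 hwf, hw]

end cubicalNerve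

/-- The canonical map to the cubical nerve of a point-finite open cover. -/
theorem exists_canonicalMap [MetricSpace Y] {O : V → Set Y} (hO : ∀ v, IsOpen (O v))
    (hcov : ⋃ v, O v = univ) (hfin : ∀ y, {v | y ∈ O v}.Finite) :
    ∃ u : Y → V → ℝ, Continuous u ∧ (∀ y v, 0 ≤ u y v ∧ u y v ≤ 1) ∧
      (∀ y v, 0 < u y v ↔ y ∈ O v) ∧ ∀ y, ∃ v, u y v = 1 := by
  classical
  rcases isEmpty_or_nonempty Y with hY | ⟨⟨y₀⟩⟩
  · exact ⟨fun y => (hY.false y).elim, continuous_of_discreteTopology, fun y => (hY.false y).elim,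
      fun y => (hY.false y).elim, fun y => (hY.false y).elim⟩
  have hV : Nonempty V := by
    obtain ⟨v, -⟩ := mem_iUnion.1 (hcov ▸ mem_univ y₀)
    exact ⟨v⟩
  -- The case `O v = univ` is separate because `Metric.infDist` to the empty set is `0`.
  let e : V → Y → ℝ := fun v y => if O v = univ then 1 else min 1 (Metric.infDist y (O v)ᶜ)
  have he0 : ∀ v y, 0 ≤ e v y := fun v y => by
    simp only [e]; split_ifs
    · exact zero_le_one
    · exact le_min zero_le_one Metric.infDist_nonneg
  have he1 : ∀ v y, e v y ≤ 1 := fun v y => by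
    simp only [e]; split_ifs
    · exact le_rfl
    · exact min_le_left _ _
  have hepos : ∀ v y, 0 < e v y ↔ y ∈ O v := fun v y => by
    simp only [e]; split_ifs with h
    · simp [h]
    · have hne : (O v)ᶜ.Nonempty := nonempty_compl.2 h
      rw [lt_min_iff, ← (hO v).isClosed_compl.notMem_iff_infDist_pos hne, notMem_compl_iff]
      exact and_iff_right one_pos
  have helip : ∀ v x y, e v x ≤ e v y + dist x y := fun v x y => by
    simp only [e]; split_ifs with h
    · linarith [dist_nonneg (x := x) (y := y)]
    · rw [← min_add_add_right]
      refine min_le_min (by linarith [dist_nonneg (x := x) (y := y)]) ?_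
      exact Metric.infDist_le_infDist_add_dist
  -- Dividing by the maximum instead of the sum makes some coordinate equal to `1`, as the cubical
  -- nerve requires; the supremum is attained by point-finiteness.
  let M : Y → ℝ := fun y => ⨆ v, e v y
  have hbdd : ∀ y, BddAbove (range fun v => e v y) := fun y =>
    ⟨1, by rintro _ ⟨v, rfl⟩; exact he1 v y⟩
  have hle : ∀ v y, e v y ≤ M y := fun v y => le_ciSup (hbdd y) v
  have hM : ∀ y, ∃ v, M y = e v y := fun y => by
    obtain ⟨w, hw⟩ := mem_iUnion.1 (hcov ▸ mem_univ y)
    obtain ⟨v, -, hmax⟩ := (hfin y).exists_maximalFor (fun v => e v y) _ ⟨w, hw⟩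
    refine ⟨v, le_antisymm (ciSup_le fun v' => ?_) (hle v y)⟩
    by_cases h : y ∈ O v'
    · exact (le_total (e v' y) (e v y)).elim id fun h' => hmax h h'
    · exact (not_lt.1 fun h' => h ((hepos v' y).1 h')).trans (he0 v y)
  have hMpos : ∀ y, 0 < M y := fun y => by
    obtain ⟨w, hw⟩ := mem_iUnion.1 (hcov ▸ mem_univ y)
    exact ((hepos w y).2 hw).trans_le (hle w y)
  have hMcont : Continuous M := by
    refine (LipPos.continuous (ε := M) ⟨hMpos, fun x y => ciSup_le fun v => ?_⟩)
    linarith [helip v x y, hle v y]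
  have hecont : ∀ v, Continuous (e v) := fun v =>
    (LipschitzWith.of_le_add fun x y => helip v x y).continuous
  refine ⟨fun y v => e v y / M y, continuous_pi fun v => (hecont v).div hMcont
    fun y => (hMpos y).ne', fun y v => ⟨div_nonneg (he0 v y) (hMpos y).le,
      (div_le_one (hMpos y)).2 (hle v y)⟩, fun y v => ?_, fun y => ?_⟩
  · rw [div_pos_iff_of_pos_right (hMpos y), hepos]
  · obtain ⟨v, hv⟩ := hM y
    refine ⟨v, ?_⟩
    simp only [← hv]
    exact div_self (hMpos y).ne'

end Nerve

/-! ### Maps with small fibres and passage to the limit. -/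

/-- Every map of a separable metric space `Y` of dimension `≤ m` can be approximated by a map `g`
such that every point of the target has a neighbourhood with small preimage. -/
theorem exists_approx_small_fibres {X : Type u} [MetricSpace X] {m : ℕ}
    (hdisc : DiscreteDiscsProperty m X) (hX : ∀ k ≤ m, ControlledFilling k X)
    {Y : Type v} [MetricSpace Y] [SecondCountableTopology Y]
    (hY : HasSmallInductiveDimensionLE Y m) {f : Y → X} (hf : Continuous f) (ε : X → ℝ)
    (hε : LipPos ε) {η : ℝ} (hη : 0 < η) :
    ∃ g : Y → X, Continuous g ∧ (∀ y, dist (g y) (f y) < ε (f y)) ∧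
      ∀ x, ∃ W ∈ 𝓝 x, ∀ y y', g y ∈ W → g y' ∈ W → dist y y' ≤ η := by
  rcases isEmpty_or_nonempty Y with hYe | ⟨⟨y₀⟩⟩
  · exact ⟨f, hf, fun y => (hYe.false y).elim, fun x => ⟨univ, univ_mem,
      fun y => (hYe.false y).elim⟩⟩
  have : Nonempty X := ⟨f y₀⟩
  have : Nonempty Y := ⟨y₀⟩
  obtain ⟨δ, hδ, hδε, hreal⟩ := GridCell.exists_realization (V := (ℕ × ℕ) × Fin (m + 1)) hdisc hX
    (m + 1) le_rfl _ (hε.mul_const (c := 1 / 2) (by norm_num) (by norm_num))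
  obtain ⟨O, oO, cO, sO, fO, nO⟩ := hY.exists_refinement
    (fun y => {z | dist z y < η / 2 ∧ dist (f z) (f y) < 1 / 16 * δ (f y)})
    (fun y => IsOpen.inter
      (isOpen_lt (f := fun z : Y => dist z y) (continuous_id.dist continuous_const) continuous_const)
      (isOpen_lt (f := fun z : Y => dist (f z) (f y)) (hf.dist continuous_const) continuous_const))
    (fun y => ⟨by rw [dist_self]; linarith, by
      rw [dist_self]; linarith [hδ.1 (f y)]⟩)
  have hOη : ∀ v, ∀ y ∈ O v, ∀ z ∈ O v, dist y z ≤ η := fun v y hy z hz => by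
    obtain ⟨w, hw⟩ := sO v
    linarith [(hw hy).1, (hw hz).1, dist_triangle_right y z w]
  have hOδ : ∀ v, ∀ y ∈ O v, ∀ z ∈ O v, dist (f y) (f z) < 1 / 4 * δ (f y) := by
    intro v y hy z hz
    obtain ⟨w, hw⟩ := sO v
    have h1 := (hw hy).2
    have h2 := (hw hz).2
    have h3 := dist_triangle_right (f y) (f z) (f w)
    have h4 := hδ.2 (f w) (f y)
    rw [dist_comm (f w)] at h4
    have h5 := hδ.1 (f y)
    linarith
  have hpf : ∀ y, {v | y ∈ O v}.Finite := fun y => by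
    obtain ⟨w, hw⟩ := mem_iUnion.1 (cO ▸ mem_univ y)
    exact (fO w).subset fun v hv => ⟨y, hw, hv⟩
  obtain ⟨u, hu, hu01, hupos, huone⟩ := exists_canonicalMap oO cO hpf
  have hbase : ∀ v, ∃ z, ((O v).Nonempty → z ∈ O v) := fun v => by
    by_cases h : (O v).Nonempty
    · exact ⟨h.some, fun _ => h.some_mem⟩
    · exact ⟨y₀, fun h' => (h h').elim⟩
  choose z hz using hbase
  obtain ⟨q, hq, hqβ⟩ := hreal (cubicalNerve O) GridCell.supp (fun v => f (z v))
    (cubicalNerve.countable fO) (fun t ht s hs => cubicalNerve.of_subset ht hs)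
    (fun s hs => cubicalNerve.finite_cofaces fO hs) (fun c hc => cubicalNerve.supp_nonempty hc)
    (fun t _ s hs => GridCell.supp_mono hs)
    (by
      intro c hc v hv w hw
      obtain ⟨y, hy⟩ := cubicalNerve.exists_mem hc
      have h1 := hOδ v _ (hz v ⟨y, hy v hv⟩) y (hy v hv)
      have h2 := hOδ w y (hy w hw) _ (hz w ⟨y, hy w hw⟩)
      have h3 := hδ.2 (f y) (f (z v))
      rw [dist_comm] at h3
      have h4 := dist_triangle (f (z v)) (f y) (f (z w))
      have h5 := hδ.1 (f (z v))
      linarith)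
  have hdim : ∀ c ∈ cubicalNerve O, c.dim < m + 1 := fun c hc => cubicalNerve.dim_lt nO hc
  have hcell := fun y => cubicalNerve.exists_cell fO (hu01 y) (hupos y) (huone y)
  have hcont : Continuous fun y => q (u y) := by
    have hlf : LocallyFinite fun c : cubicalNerve O => u ⁻¹' c.1.carrier := by
      intro y
      obtain ⟨w, hw⟩ := mem_iUnion.1 (cO ▸ mem_univ y)
      refine ⟨O w, (oO w).mem_nhds hw, ?_⟩
      refine Finite.of_finite_image (f := Subtype.val) ?_ Subtype.val_injective.injOn
      refine ((fO w).biUnion fun v _ => cubicalNerve.finite_mem_supp fO v).subset ?_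
      rintro _ ⟨⟨c, hc⟩, ⟨y', hy', hyw'⟩, rfl⟩
      obtain ⟨v, hv⟩ := huone y'
      have hpos : 0 < u y' v := by rw [hv]; exact one_pos
      exact mem_biUnion (x := v) ⟨y', hyw', (hupos y' v).1 hpos⟩ ⟨hc, u y', hy', hpos⟩
    refine hlf.continuous (eq_univ_of_forall fun y => ?_)
      (fun c => c.1.isClosed_carrier.preimage hu)
      (fun c => (hq.continuousOn c.1 c.2 (hdim _ c.2)).comp hu.continuousOn fun y hy => hy)
    obtain ⟨c, hc, hyc, -⟩ := hcell y
    exact mem_iUnion.2 ⟨⟨c, hc⟩, hyc⟩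
  refine ⟨fun y => q (u y), hcont, fun y => ?_, fun x => ?_⟩
  · obtain ⟨c, hc, hyc, hcO⟩ := hcell y
    obtain ⟨v, hv⟩ := cubicalNerve.supp_nonempty hc
    have h1 := hqβ c hc (hdim c hc) (u y) hyc v hv
    have hyv := hcO v hv
    have h2 := hOδ v y hyv _ (hz v ⟨y, hyv⟩)
    have h3 := hε.2 (f (z v)) (f y)
    rw [dist_comm (f (z v))] at h3
    have h4 := dist_triangle_right (q (u y)) (f y) (f (z v))
    have h5 := hδε (f y)
    have h6 := hε.1 (f y)
    linarith
  · have hcl : ∀ c : {c // c ∈ cubicalNerve O ∧ c.dim < m + 1}, IsClosed (q '' c.1.carrier) :=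
      fun c => (c.1.isCompact_carrier.image_of_continuousOn
        (hq.continuousOn c.1 c.2.1 c.2.2)).isClosed
    -- The neighbourhood is the complement of all closed cell images not containing `x`; local
    -- finiteness makes it a neighbourhood.
    refine ⟨_, hq.locallyFinite.iInter_compl_mem_nhds hcl x, fun y y' hy hy' => ?_⟩
    have hmem : ∀ y, q (u y) ∈ ⋂ (c : {c // c ∈ cubicalNerve O ∧ c.dim < m + 1})
        (_ : x ∉ q '' c.1.carrier), (q '' c.1.carrier)ᶜ →
        ∃ c ∈ cubicalNerve O, x ∈ q '' c.carrier ∧ ∀ v ∈ c.supp, y ∈ O v := by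
      intro y hy
      obtain ⟨c, hc, hyc, hcO⟩ := hcell y
      refine ⟨c, hc, by_contra fun hx => ?_, hcO⟩
      exact mem_iInter₂.1 hy ⟨c, hc, hdim c hc⟩ hx (mem_image_of_mem q hyc)
    obtain ⟨c, hc, hxc, hcO⟩ := hmem y hy
    obtain ⟨c', hc', hxc', hcO'⟩ := hmem y' hy'
    -- Both cell images contain `x`, so the cells meet. A coordinate equal to `1` at a common point
    -- is in both supports and names a member of the cover containing `y` and `y'`.
    have hnd : ¬ Disjoint c.carrier c'.carrier := fun h =>
      (hq.disjoint c hc (hdim c hc) c' hc' (hdim c' hc') h).notMem_of_mem_left hxc hxc'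
    obtain ⟨p, hp, hp'⟩ := not_disjoint_iff.1 hnd
    obtain ⟨v, hv⟩ := hc.2.1 p hp
    have hpos : 0 < p v := by rw [hv]; exact one_pos
    exact hOη v y (hcO v ⟨p, hp, hpos⟩) y' (hcO' v ⟨p, hp', hpos⟩)

/-- Applied at `g y`, the condition gives injectivity. If the image of an ultrafilter converges, the
ultrafilter contains sets of arbitrarily small diameter, so it converges by completeness of `Y`, and
`g` is proper. -/
theorem isClosedEmbedding_of_small_fibres {X Y : Type*} [MetricSpace X] [MetricSpace Y]
    [CompleteSpace Y] {g : Y → X} (hg : Continuous g)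
    (h : ∀ η > 0, ∀ x, ∃ W ∈ 𝓝 x, ∀ y y', g y ∈ W → g y' ∈ W → dist y y' < η) :
    IsClosedEmbedding g := by
  refine IsClosedEmbedding.of_continuous_injective_isClosedMap hg (fun y y' hyy => ?_) ?_
  · refine dist_le_zero.1 (le_of_forall_pos_lt_add fun η hη => ?_)
    obtain ⟨W, hW, hd⟩ := h η hη (g y)
    rw [zero_add]
    exact hd y y' (mem_of_mem_nhds hW) (hyy ▸ mem_of_mem_nhds hW)
  · refine IsProperMap.isClosedMap (isProperMap_iff_ultrafilter.2 ⟨hg, fun F x hF => ?_⟩)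
    have hC : Cauchy (F : Filter Y) := by
      refine Metric.cauchy_iff.2 ⟨inferInstance, fun η hη => ?_⟩
      obtain ⟨W, hW, hd⟩ := h η hη x
      exact ⟨_, hF hW, fun y hy y' hy' => hd y y' hy hy'⟩
    obtain ⟨y, hy⟩ := CompleteSpace.complete hC
    exact ⟨y, tendsto_nhds_unique (hg.continuousAt.mono_left hy) hF, hy⟩

theorem exists_approx_isClosedEmbedding {X : Type u} [MetricSpace X] [CompleteSpace X] {m : ℕ}
    (hdisc : DiscreteDiscsProperty m X) (hX : ∀ k ≤ m, ControlledFilling k X)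
    {Y : Type v} [MetricSpace Y] [CompleteSpace Y] [SecondCountableTopology Y]
    (hY : HasSmallInductiveDimensionLE Y m) {f : Y → X} (hf : Continuous f) (ε : X → ℝ)
    (hε : LipPos ε) :
    ∃ g : Y → X, IsClosedEmbedding g ∧ ∀ y, dist (g y) (f y) < ε (f y) := by
  -- A stage carries a map and a control function. The new function is at most a quarter of the old
  -- one and so small that its balls have preimages of diameter at most (1/2)^n; the next correction
  -- is measured by it.
  have hstep : ∀ (n : ℕ) (p : {p : (Y → X) × (X → ℝ) // Continuous p.1 ∧ LipPos p.2}),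
      ∃ p' : {p : (Y → X) × (X → ℝ) // Continuous p.1 ∧ LipPos p.2},
        (∀ y, dist (p'.1.1 y) (p.1.1 y) < 1 / 16 * p.1.2 (p.1.1 y)) ∧
        (∀ x, p'.1.2 x ≤ 1 / 4 * p.1.2 x) ∧
        ∀ x y y', dist (p'.1.1 y) x < p'.1.2 x → dist (p'.1.1 y') x < p'.1.2 x →
          dist y y' ≤ (1 / 2) ^ n := by
    rintro n ⟨⟨g, δ⟩, hg, hδ⟩
    obtain ⟨g', hg', hgg', hW⟩ := exists_approx_small_fibres hdisc hX hY hg _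
      (hδ.mul_const (c := 1 / 16) (by norm_num) (by norm_num)) (η := (1 / 2) ^ n) (by positivity)
    have hex : ∀ x, ∃ r > 0, ∀ y y', g' y ∈ Metric.ball x r → g' y' ∈ Metric.ball x r →
        dist y y' ≤ (1 / 2) ^ n := fun x => by
      obtain ⟨W, hW, hd⟩ := hW x
      obtain ⟨r, hr, hrW⟩ := Metric.mem_nhds_iff.1 hW
      exact ⟨r, hr, fun y y' hy hy' => hd y y' (hrW hy) (hrW hy')⟩
    choose r hr hrd using hex
    obtain ⟨δ', hδ', hb⟩ := exists_lipPos_ball_subset r hr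
    refine ⟨⟨(g', fun x => min (1 / 4 * δ x) (δ' x)), hg',
      (hδ.mul_const (by norm_num) (by norm_num)).min hδ'⟩, hgg', fun x => min_le_left _ _,
      fun x y y' hy hy' => ?_⟩
    obtain ⟨x', hx'⟩ := hb x
    exact hrd x' y y' (hx' (hy.trans_le (min_le_right _ _))) (hx' (hy'.trans_le (min_le_right _ _)))
  choose step hs1 hs2 hs3 using hstep
  let p : ℕ → {p : (Y → X) × (X → ℝ) // Continuous p.1 ∧ LipPos p.2} := fun n =>
    Nat.rec ⟨(f, fun x => min (ε x) 1), hf, hε.min lipPos_one⟩ (fun n p => step n p) n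
  have hp : ∀ n, p (n + 1) = step n (p n) := fun n => rfl
  let G : ℕ → Y → X := fun n => (p n).1.1
  let E : ℕ → X → ℝ := fun n => (p n).1.2
  have hG : ∀ n, Continuous (G n) := fun n => (p n).2.1
  have hE : ∀ n, LipPos (E n) := fun n => (p n).2.2
  have hGd : ∀ n y, dist (G (n + 1) y) (G n y) < 1 / 16 * E n (G n y) := fun n y => hs1 n (p n) y
  have hEd : ∀ n x, E (n + 1) x ≤ 1 / 4 * E n x := fun n x => hs2 n (p n) x
  have hfib : ∀ n x y y', dist (G (n + 1) y) x < E (n + 1) x →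
      dist (G (n + 1) y') x < E (n + 1) x → dist y y' ≤ (1 / 2) ^ n := fun n => hs3 n (p n)
  have hEG : ∀ n y, E (n + 1) (G (n + 1) y) ≤ 1 / 2 * E n (G n y) := fun n y => by
    have h1 := hEd n (G (n + 1) y)
    have h2 := (hE n).2 (G (n + 1) y) (G n y)
    have h3 := hGd n y
    have h4 := (hE n).1 (G n y)
    linarith
  -- The tolerances along the orbit of `y` halve at each stage, so the corrections, starting at
  -- 1/16, sum to at most 1/8 of the current tolerance.
  have hdist : ∀ k n y, dist (G (n + k) y) (G n y) ≤ 1 / 8 * E n (G n y) := by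
    intro k
    induction k with
    | zero =>
      intro n y
      rw [add_zero, dist_self]
      linarith [(hE n).1 (G n y)]
    | succ k ih =>
      intro n y
      have h1 := ih (n + 1) y
      rw [show n + 1 + k = n + (k + 1) by ring] at h1
      have h2 := dist_triangle (G (n + (k + 1)) y) (G (n + 1) y) (G n y)
      linarith [hEG n y, hGd n y]
  have hEpow : ∀ n y, E n (G n y) ≤ (1 / 2) ^ n := by
    intro n y
    induction n with
    | zero => rw [pow_zero]; exact min_le_right _ _
    | succ n ih => rw [pow_succ]; linarith [hEG n y]
  have hpow : Tendsto (fun n : ℕ => ((1 : ℝ) / 2) ^ n) atTop (𝓝 0) :=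
    tendsto_pow_atTop_nhds_zero_of_lt_one (by norm_num) (by norm_num)
  have hcau : ∀ y, CauchySeq fun n => G n y := fun y => by
    refine cauchySeq_of_le_tendsto_0' (fun n => ((1 : ℝ) / 2) ^ n) (fun n k hnk => ?_) hpow
    obtain ⟨j, rfl⟩ := Nat.exists_eq_add_of_le hnk
    rw [dist_comm]
    have := hdist j n y
    linarith [hEpow n y, (hE n).1 (G n y)]
  choose g hg using fun y => cauchySeq_tendsto_of_complete (hcau y)
  have hgd : ∀ n y, dist (g y) (G n y) ≤ 1 / 8 * E n (G n y) := fun n y => by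
    refine le_of_tendsto ((hg y).dist tendsto_const_nhds) ?_
    filter_upwards [eventually_ge_atTop n] with k hk
    obtain ⟨j, rfl⟩ := Nat.exists_eq_add_of_le hk
    exact hdist j n y
  have hgc : Continuous g := by
    have : TendstoUniformly G g atTop := by
      rw [Metric.tendstoUniformly_iff]
      intro η hη
      filter_upwards [(tendsto_order.1 hpow).2 η hη] with n hn y
      have := hgd n y
      linarith [hEpow n y, (hE n).1 (G n y)]
    exact this.continuous (Frequently.of_forall hG)
  refine ⟨g, isClosedEmbedding_of_small_fibres hgc fun η hη x => ?_, fun y => ?_⟩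
  · obtain ⟨n, hn⟩ := ((tendsto_order.1 hpow).2 η hη).exists
    have hx := (hE (n + 1)).1 x
    -- If the limit is within a quarter of the tolerance at `x`, the map of stage `n + 1` is still
    -- within the full tolerance, so its fibre estimate passes to the limit.
    refine ⟨Metric.ball x (1 / 4 * E (n + 1) x), Metric.ball_mem_nhds _ (by linarith),
      fun y y' hy hy' => (hfib n x y y' ?_ ?_).trans_lt hn⟩
    all_goals
      rw [Metric.mem_ball] at hy hy'
    · have h1 := hgd (n + 1) y
      have h2 := (hE (n + 1)).2 (G (n + 1) y) x
      have h3 := dist_triangle_left (G (n + 1) y) x (g y)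
      linarith
    · have h1 := hgd (n + 1) y'
      have h2 := (hE (n + 1)).2 (G (n + 1) y') x
      have h3 := dist_triangle_left (G (n + 1) y') x (g y')
      linarith
  · have h1 : dist (g y) (f y) ≤ 1 / 8 * min (ε (f y)) 1 := hgd 0 y
    have h2 := min_le_left (ε (f y)) 1
    have h3 := hε.1 (f y)
    linarith

theorem mainTheorem6 (m : ℕ) (X : Type u) [TopologicalSpace X] [PolishSpace X]
    (hconn : ∀ k : ℕ, k < m → LocallyKConnected k X) (hdisc : DiscreteDiscsProperty m X) :
    StronglyUniversal.{u, v} m X := by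
  intro Y _ _ hY f hf 𝒰 h𝒰
  let := TopologicalSpace.upgradeIsCompletelyMetrizable X
  let := TopologicalSpace.upgradeIsCompletelyMetrizable Y
  obtain ⟨ε, hε, hε𝒰⟩ := exists_lipPos_of_isOpenCovering h𝒰
  obtain ⟨g, hg, hgf⟩ := exists_approx_isClosedEmbedding hdisc
    -- Filling a cube of positive dimension `k ≤ m` uses connectedness in degree `k - 1`, which is
    -- below `m`.
    (fun k hk => controlledFilling_of_locallyKConnected fun j hj => hconn j (by omega)) hY hf ε hε
  refine ⟨g, hg, fun y => ?_⟩
  obtain ⟨U, hU, hb⟩ := hε𝒰 (f y)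
  exact ⟨U, hU, hb (Metric.mem_ball_self (hε.1 _)), hb (hgf y)⟩
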